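/- **Setting.** Let $\mathcal S,\mathcal A$ be finite non-empty sets, $\mathcal P$ a transition kernel from $\mathcal S\times\mathcal A$ to $\mathcal S$, $\rho$ an initial state distribution, $\gamma\in(0,1)$. For a stationary policy $\pi$ let $\lambda^\pi(s,a)=\sum_{t\ge0}\gamma^t\,\mathbb P_{\rho,\pi}(s_t=s,a_t=a)$, and let $\Lambda=\{\lambda^\pi\}\subset\mathbb R^{\mathcal S\times\mathcal A}$ be the set of all these occupancy measures. Let $\pi_\theta(a|s)\propto\exp\psi(s,a;\theta)$, $\theta\in\mathbb R^d$, be a softmax parametrization, write $\lambda(\theta)=\lambda^{\pi_\theta}$, and let $F:\mathbb R^{\mathcal S\times\mathcal A}\to\mathbb R$ be differentiable. For a trajectory $\tau=(s_0,a_0,\dots,s_{H-1},a_{H-1})$ put $\lambda(\tau)=\sum_{h<H}\gamma^h\delta_{s_h,a_h}$, $g(\tau,\theta,r)=\sum_{t<H}\big(\sum_{h=t}^{H-1}\gamma^h r(s_h,a_h)\big)\nabla_\theta\log\pi_\theta(a_t|s_t)$ and $w(\tau|\theta',\theta)=\prod_{h<H}\pi_{\theta'}(a_h|s_h)/\pi_\theta(a_h|s_h)$.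 **Algorithm (N-VR-PG)**, with input $\theta_0,T,H,(\eta_t),(\alpha_t)$. Sample $\tau_0$ of length $H$ from $\pi_{\theta_0}$; set $\lambda_0=\lambda(\tau_0)$, $r_{-1}=r_0=\nabla F(\lambda_0)$, $d_0=g(\tau_0,\theta_0,r_0)$, $\theta_1=\theta_0+\alpha_0 d_0/\|d_0\|$ (with the step size of index $0$). For $t=1,\dots,T-1$: sample $\tau_t$ of length $H$ from $\pi_{\theta_t}$ and, with $w_t=w(\tau_t|\theta_{t-1},\theta_t)$, set $\lambda_t=\eta_t\lambda(\tau_t)+(1-\eta_t)\big(\lambda_{t-1}+(1-w_t)\lambda(\tau_t)\big)$, $r_t=\nabla F(\lambda_t)$, $d_t=\eta_t g(\tau_t,\theta_t,r_{t-1})+(1-\eta_t)\big(d_{t-1}+g(\tau_t,\theta_t,r_{t-1})-w_t\,g(\tau_t,\theta_{t-1},r_{t-2})\big)$, $\theta_{t+1}=\theta_t+\alpha_t d_t/\|d_t\|$. (If $d_t=0$, then $\theta_{t+1}=\theta_t$.) **Assumptions.** Let $l_\psi,L_\psi,l_\lambda,L_\lambda,L_{\lambda,\infty},\ell_\theta>0$.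 1. Each $\psi(s,a;\cdot)$ is $C^2$ with $\|\nabla\psi(s,a;\theta)\|\le l_\psi$ and $\|\nabla^2\psi(s,a;\theta)\|\le L_\psi$ for all $\theta$. 2. For all $\mu,\nu\in\mathbb R^{\mathcal S\times\mathcal A}$: $\|\nabla F(\mu)\|_\infty\le l_\lambda$ and $\|\nabla F(\mu)-\nabla F(\nu)\|_\infty\le\min\{L_\lambda\|\mu-\nu\|_2,\ L_{\lambda,\infty}\|\mu-\nu\|_1\}$. 3. $F$ is concave on $\Lambda$ (a convex set), and $\theta^*\in\mathbb R^d$ maximizes $\theta\mapsto F(\lambda(\theta))$ over $\mathbb R^d$; $F^\star=F(\lambda(\theta^*))$. 4. (Local bijection with parameter $\bar\epsilon$.) There is a set $\Theta\subset\mathbb R^d$ that almost surely contains the iterates $\theta_0,\dots,\theta_{T-1}$ (for instance $\Theta=\mathbb R^d$), such that for each $\theta\in\Theta$ there are sets $U_\theta\ni\theta$ in $\mathbb R^d$ and $V_\theta\ni\lambda(\theta)$ in $\Lambda$ for which $\lambda:U_\theta\to V_\theta$ is a bijection with $\ell_\theta$-Lipschitz inverse, and $(1-\epsilon)\lambda(\theta)+\epsilon\lambda(\theta^*)\in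 V_\theta$ for all $0<\epsilon\le\bar\epsilon$. **Theorem.** There is a constant $C$ depending only on $l_\psi,L_\psi,l_\lambda,L_\lambda,L_{\lambda,\infty},\ell_\theta$ such that the following holds for all $a,\gamma\in(0,1)$ and $\alpha_0>0$. Run N-VR-PG for $T\ge1$ iterations with the constant step sizes $\alpha_t=\alpha_0/(T+1)^a$, with $\eta_t=2/(t+1)$ and $H=\lceil\log(T+1)/(1-\gamma)\rceil$, and suppose that Assumptions 1–4 hold with $\bar\epsilon\ge\frac{\alpha_0(1-\gamma)}{2\ell_\theta(T+1)^a}$. Then, as $T\to\infty$, $$F^\star-\mathbb E[F(\lambda(\theta_T))]\le C\,\frac{\alpha_0^2}{(1-\gamma)^3(T+1)^{2a-3/2}}\qquad\text{for all }T\ge T_0,$$ where $T_0$ depends only on $a,\gamma,\alpha_0$ and the six constants above; and the same bound holds for every $T\ge1$ with $C$ replaced by a constant $K$ that may depend also on $a,\gamma,\alpha_0$. Moreover, let $a>3/4$ and $\alpha_0=(1-\gamma)^{3/2}$. Then for all sufficiently small $\varepsilon>0$ (depending on $a,\gamma$ and the six constants) there is a number of iterations $T_\varepsilon$, depending only on $\varepsilon,a,\gamma$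 and the six constants, whose total number $T_\varepsilon H$ of sampled state-action pairs is at most $C\,\varepsilon^{-2/(4a-3)}$, such that $F^\star-\mathbb E[F(\lambda(\theta_T))]\le\varepsilon$ for every $T\ge T_\varepsilon$ for which the assumptions hold. -/

import Mathlib

noncomputable section

namespace NVRPG

/-- Transition kernel and initial state distribution of a finite Markov decision process. The
discount factor and the utility function are passed separately. -/
structure MDP (S A : Type*) [Fintype S] where
  /-- `P s a s'` is the probability of moving from `s` to `s'` under the action `a`. -/
  P : S → A → S → ℝ
  P_nonneg : ∀ s a s', 0 ≤ P s a s'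
  P_sum : ∀ s a, ∑ s', P s a s' = 1
  /-- The initial state distribution. -/
  ρ : S → ℝ
  ρ_nonneg : ∀ s, 0 ≤ ρ s
  ρ_sum : ∑ s, ρ s = 1

/-- The parameter space `ℝ^d` with its Euclidean norm. -/
abbrev Param (d : ℕ) : Type := EuclideanSpace ℝ (Fin d)

/-- Vectors indexed by state-action pairs, with the Euclidean norm. -/
abbrev SAVec (S A : Type*) : Type _ := EuclideanSpace ℝ (S × A)

/-- Trajectories `(s_0, a_0, …, s_{H-1}, a_{H-1})` of length `H`. -/
abbrev Traj (S A : Type*) (H : ℕ) : Type _ := Fin H → S × A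

variable {S A : Type*} [Fintype S] [Fintype A] [DecidableEq S] [DecidableEq A] {d : ℕ}

/-- A stationary (randomized) policy, `π s a` being the probability of `a` in state `s`. -/
def IsPolicy (π : S → A → ℝ) : Prop :=
  (∀ s a, 0 ≤ π s a) ∧ ∀ s, ∑ a, π s a = 1

/-- Probability that the first `H` state-action pairs of the Markov chain with initial state
distribution `ρ` and policy `π` are `τ`. -/
def MDP.trajProb (M : MDP S A) (π : S → A → ℝ) : (H : ℕ) → Traj S A H → ℝ
  | 0, _ => 1
  | 1, τ => M.ρ (τ 0).1 * π (τ 0).1 (τ 0).2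
  | H + 2, τ =>
      M.trajProb π (H + 1) (Fin.init τ) *
        (M.P (τ (Fin.last H).castSucc).1 (τ (Fin.last H).castSucc).2 (τ (Fin.last (H + 1))).1 *
          π (τ (Fin.last (H + 1))).1 (τ (Fin.last (H + 1))).2)

/-- Probability that the state-action pair at time `t` is `x`. -/
def MDP.saProb (M : MDP S A) (π : S → A → ℝ) (t : ℕ) (x : S × A) : ℝ :=
  ∑ τ : Traj S A (t + 1), if τ (Fin.last t) = x then M.trajProb π (t + 1) τ else 0

/-- The discounted state-action occupancy measure of a policy. -/
def MDP.occupancy (M : MDP S A) (γ : ℝ) (π : S → A → ℝ) : SAVec S A :=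
  WithLp.toLp 2 fun x => ∑' t : ℕ, γ ^ t * M.saProb π t x

/-- The set of the occupancy measures of all stationary policies. -/
def MDP.occupancySet (M : MDP S A) (γ : ℝ) : Set (SAVec S A) :=
  {μ | ∃ π, IsPolicy π ∧ M.occupancy γ π = μ}

/-- The softmax policy with parameter `θ`. -/
def softmax (ψ : S → A → Param d → ℝ) (θ : Param d) (s : S) (a : A) : ℝ :=
  Real.exp (ψ s a θ) / ∑ b, Real.exp (ψ s b θ)

/-- The occupancy measure of the softmax policy with parameter `θ`. -/
def occ (M : MDP S A) (γ : ℝ) (ψ : S → A → Param d → ℝ) (θ : Param d) : SAVec S A :=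
  M.occupancy γ (softmax ψ θ)

/-- The truncated policy gradient estimate along `τ` for the reward vector `r`. -/
def pgEst (γ : ℝ) (ψ : S → A → Param d → ℝ) {H : ℕ} (τ : Traj S A H) (θ : Param d)
    (r : SAVec S A) : Param d :=
  ∑ t : Fin H, (∑ h ∈ Finset.Ici t, γ ^ (h : ℕ) * r (τ h)) •
    gradient (fun ϑ => Real.log (softmax ψ ϑ (τ t).1 (τ t).2)) θ

/-- The truncated occupancy measure estimate along `τ`. -/
def occEst (γ : ℝ) {H : ℕ} (τ : Traj S A H) : SAVec S A :=
  ∑ h : Fin H, γ ^ (h : ℕ) • EuclideanSpace.single (τ h) (1 : ℝ)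

/-- The importance sampling weight `w(τ | θ', θ)`. -/
def isWeight (ψ : S → A → Param d → ℝ) {H : ℕ} (τ : Traj S A H) (θ' θ : Param d) : ℝ :=
  ∏ h : Fin H, softmax ψ θ' (τ h).1 (τ h).2 / softmax ψ θ (τ h).1 (τ h).2

/-- The variables kept by the algorithm when `t` trajectories have been used. -/
structure State (S A : Type*) (d : ℕ) where
  /-- the iterate `θ_t` -/
  θ : Param d
  /-- the previous iterate `θ_{t-1}` -/
  θprev : Param d
  /-- the occupancy measure estimate `λ_{t-1}` -/
  lam : SAVec S A
  /-- the reward vector `r_{t-1}` -/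
  r : SAVec S A
  /-- the reward vector `r_{t-2}` -/
  rprev : SAVec S A
  /-- the direction `d_{t-1}` -/
  dir : Param d

/-- The normalized update; it leaves `θ` unchanged if the direction vanishes. -/
def normStep (α : ℝ) (θ v : Param d) : Param d :=
  θ + (α / ‖v‖) • v

/-- Iteration `t` of the algorithm, using the trajectory `τ = τ_t`. Iteration `0` only reads the
initial parameter from the given state. -/
def step (γ : ℝ) (ψ : S → A → Param d → ℝ) (F : SAVec S A → ℝ) (η α : ℕ → ℝ) {H : ℕ} :
    ℕ → State S A d → Traj S A H → State S A d
  | 0, s, τ =>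
      let lam := occEst γ τ
      let r := gradient F lam
      let dir := pgEst γ ψ τ s.θ r
      { θ := normStep (α 0) s.θ dir
        θprev := s.θ
        lam := lam
        r := r
        rprev := r
        dir := dir }
  | t + 1, s, τ =>
      let w := isWeight ψ τ s.θprev s.θ
      let u := (1 - w) • occEst γ τ
      let lam := η (t + 1) • occEst γ τ + (1 - η (t + 1)) • (s.lam + u)
      let v := pgEst γ ψ τ s.θ s.r - w • pgEst γ ψ τ s.θprev s.rprev
      let dir := η (t + 1) • pgEst γ ψ τ s.θ s.r + (1 - η (t + 1)) • (s.dir + v)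
      { θ := normStep (α (t + 1)) s.θ dir
        θprev := s.θ
        lam := lam
        r := gradient F lam
        rprev := s.r
        dir := dir }

/-- The state of the algorithm started at `θ₀` once the `n` trajectories `ω` have been used; its
component `θ` is the iterate `θ_n`. The zeros in the initial state are never read. -/
def run (γ : ℝ) (ψ : S → A → Param d → ℝ) (F : SAVec S A → ℝ) (η α : ℕ → ℝ) (H : ℕ)
    (θ₀ : Param d) : (n : ℕ) → (Fin n → Traj S A H) → State S A d
  | 0, _ => { θ := θ₀, θprev := θ₀, lam := 0, r := 0, rprev := 0, dir := 0 }
  | n + 1, ω => step γ ψ F η α n (run γ ψ F η α H θ₀ n (Fin.init ω)) (ω (Fin.last n))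

/-- Probability that the first `n` trajectories sampled by the algorithm are `ω`: given the past,
trajectory `t` is sampled from the process with the softmax policy of parameter `θ_t`. -/
def runProb (M : MDP S A) (γ : ℝ) (ψ : S → A → Param d → ℝ) (F : SAVec S A → ℝ) (η α : ℕ → ℝ)
    (H : ℕ) (θ₀ : Param d) : (n : ℕ) → (Fin n → Traj S A H) → ℝ
  | 0, _ => 1
  | n + 1, ω =>
      runProb M γ ψ F η α H θ₀ n (Fin.init ω) *
        M.trajProb (softmax ψ (run γ ψ F η α H θ₀ n (Fin.init ω)).θ) H (ω (Fin.last n))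

/-- The expected utility `𝔼[F(λ(θ_T))]` of the iterate `θ_T`. -/
def expectedUtility (M : MDP S A) (γ : ℝ) (ψ : S → A → Param d → ℝ) (F : SAVec S A → ℝ)
    (η α : ℕ → ℝ) (H : ℕ) (θ₀ : Param d) (T : ℕ) : ℝ :=
  ∑ ω : Fin T → Traj S A H,
    runProb M γ ψ F η α H θ₀ T ω * F (occ M γ ψ (run γ ψ F η α H θ₀ T ω).θ)

/-- The horizon `log (T + 1) / (1 - γ)`, rounded up. -/
def horizon (γ : ℝ) (T : ℕ) : ℕ := ⌈Real.log (T + 1) / (1 - γ)⌉₊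

/-- The momentum parameters `η_t = 2 / (t + 1)`. -/
def etaSeq (t : ℕ) : ℝ := 2 / ((t : ℝ) + 1)

/-- The constant step sizes `α_t = α₀ / (T + 1) ^ a`. -/
def alphaSeq (α₀ a : ℝ) (T : ℕ) (_t : ℕ) : ℝ := α₀ / ((T : ℝ) + 1) ^ a

/-- The optimality gap `F(λ(θs)) - 𝔼[F(λ(θ_T))]` after the `T` iterations of the algorithm with
`α_t = α₀ / (T + 1) ^ a`, `η_t = 2 / (t + 1)` and horizon `log (T + 1) / (1 - γ)`. -/
def optGap (M : MDP S A) (γ : ℝ) (ψ : S → A → Param d → ℝ) (F : SAVec S A → ℝ) (θ₀ θs : Param d)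
    (α₀ a : ℝ) (T : ℕ) : ℝ :=
  F (occ M γ ψ θs) -
    expectedUtility M γ ψ F etaSeq (alphaSeq α₀ a T) (horizon γ T) θ₀ T

/-- The rate `α₀² / ((1 - γ)³ (T + 1) ^ (2 a - 3 / 2))`. -/
def rate (α₀ γ a : ℝ) (T : ℕ) : ℝ :=
  α₀ ^ 2 / ((1 - γ) ^ 3 * ((T : ℝ) + 1) ^ (2 * a - 3 / 2))

/-- `Θ` contains, almost surely, the iterates `θ_0, …, θ_{T-1}` of that algorithm. -/
def IteratesIn (M : MDP S A) (γ : ℝ) (ψ : S → A → Param d → ℝ) (F : SAVec S A → ℝ) (θ₀ : Param d)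
    (α₀ a : ℝ) (T : ℕ) (Θ : Set (Param d)) : Prop :=
  ∀ t < T, ∀ ω : Fin t → Traj S A (horizon γ T),
    0 < runProb M γ ψ F etaSeq (alphaSeq α₀ a T) (horizon γ T) θ₀ t ω →
    (run γ ψ F etaSeq (alphaSeq α₀ a T) (horizon γ T) θ₀ t ω).θ ∈ Θ

/-- Regularity of the softmax parametrization. -/
structure PolicyRegular (ψ : S → A → Param d → ℝ) (lψ Lψ : ℝ) : Prop where
  contDiff : ∀ s a, ContDiff ℝ 2 (ψ s a)
  grad_le : ∀ s a θ, ‖gradient (ψ s a) θ‖ ≤ lψ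
  hess_le : ∀ s a θ, ‖fderiv ℝ (gradient (ψ s a)) θ‖ ≤ Lψ

/-- Regularity of the utility. The gradient of `F` is bounded in the sup norm, and Lipschitz from
the Euclidean norm and from the `ℓ¹` norm to the sup norm. The algorithm evaluates the gradient of
`F` at the estimates `λ_t`, which are arbitrary vectors. -/
structure UtilityRegular (F : SAVec S A → ℝ) (l L Linf : ℝ) : Prop where
  differentiable : Differentiable ℝ F
  grad_le : ∀ μ i, |gradient F μ i| ≤ l
  grad_lip : ∀ μ ν i, |gradient F μ i - gradient F ν i| ≤ L * ‖μ - ν‖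
  grad_lip_one : ∀ μ ν i, |gradient F μ i - gradient F ν i| ≤ Linf * ∑ j, |μ j - ν j|

/-- Local invertibility of `θ ↦ λ(θ)` at the parameters in `Θ`, with an `ℓ`-Lipschitz inverse on a
piece `V` of the set of occupancy measures that contains the beginning of the segment from `λ(θ)`
to `λ(θs)`. The sets `U` and `V` are not required to be open, so that redundant parametrizations
such as the tabular softmax are allowed. -/
def LocallyInvertible (M : MDP S A) (γ : ℝ) (ψ : S → A → Param d → ℝ) (θs : Param d)
    (Θ : Set (Param d)) (ℓ εbar : ℝ) : Prop :=
  ∀ θ ∈ Θ, ∃ (U : Set (Param d)) (V : Set (SAVec S A)),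
    θ ∈ U ∧ occ M γ ψ θ ∈ V ∧ V ⊆ M.occupancySet γ ∧
    Set.BijOn (occ M γ ψ) U V ∧
    (∀ x ∈ U, ∀ y ∈ U, ‖x - y‖ ≤ ℓ * ‖occ M γ ψ x - occ M γ ψ y‖) ∧
    ∀ ε : ℝ, 0 < ε → ε ≤ εbar → (1 - ε) • occ M γ ψ θ + ε • occ M γ ψ θs ∈ V

end NVRPG

end

set_option linter.unusedSectionVars false

noncomputable section

namespace NVRPG

variable {S A : Type*} [Fintype S] [Fintype A]

/-! The proof yields more than the stated rate, so the dependence on the constants need not be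
tracked. Let `N` dominate `1`, `1/(1-γ)`, the horizon and the six constants; `N` can be taken of
order `log T`. Every estimate is polynomial in `N`, and `gap_le` bounds the gap by a polylogarithm
of `T` times `T^(-1/2) + T^(1/2-a)`, plus a stretched exponential. For `a < 1` the exponent `3a/2 -
1` lies strictly below `1/2` and `a - 1/2` and strictly above `2a - 3/2`. The first margin absorbs
the logarithms (`eventually_convergence_bound_le`), the second the factor `α₀²/(1-γ)³`
(`eventually_rpow_neg_le_rate`). Hence `C = 1` suffices, and the logarithmic horizon fits into the
sampling cost.

Ascent (`State.Bounded.gap_step_le`). Although `θ ↦ F(λ(θ))` is not concave, local invertibility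
gives a parameter `θ'` within `α` of `θ_t` whose occupancy measure lies a fraction `ε = α/(2N²)` of
the way to the optimum. By concavity of `F` on occupancy measures, the gap at `θ'` is at most `1 -
ε` times the gap at `θ_t`. The normalized step maximizes the linear form `⟨d_t, ·⟩` on the ball of
radius `α`, so `θ_{t+1}` does as well as `θ'` up to `2α` times the error of the linear model. Since
`α/ε = 2N²`, these errors accumulate to a multiple of their size rather than growing with `T`.

Linear model (`MDP.abs_utility_sub_sub_inner_meanGrad_le`). The map `λ(θ)` is never differentiated:
the truncated occupancy measure at `θ'` is an importance weighted expectation at `θ`, and the weight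
is expanded to first order.

Estimation error (`expect_err_le`). Conditionally on the past, each error is `1 - η` times the
previous one plus centred noise. Small steps force the importance weights to be within `O(N²α)` of
`1` surely, so this noise is `O(η + α)` up to powers of `N`, with no assumption on the variance of
the weights. With `η_t = 2/(t+1)` the recursion gives root mean square errors of order `T^(-1/2) + α
T^(1/2)` in the second half of the run, which is the only part used. -/

/-! ### Laws of trajectories. -/

lemma sum_fin_succ_snoc {X E : Type*} [Fintype X] [AddCommMonoid E] {n : ℕ}
    (f : (Fin (n + 1) → X) → E) :
    ∑ ω, f ω = ∑ ω : Fin n → X, ∑ x, f (Fin.snoc ω x) := by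
  rw [Finset.sum_comm, ← Fintype.sum_prod_type' (f := fun x (ω : Fin n → X) => f (Fin.snoc ω x))]
  exact (Fintype.sum_equiv (Fin.snocEquiv fun _ : Fin (n + 1) => X) _ _ fun _ => rfl).symm

/-- The distribution of the next state given the trajectory so far. -/
def MDP.nextState (M : MDP S A) : (H : ℕ) → Traj S A H → S → ℝ
  | 0, _, s => M.ρ s
  | H + 1, τ, s => M.P (τ (Fin.last H)).1 (τ (Fin.last H)).2 s

lemma MDP.nextState_nonneg (M : MDP S A) (H : ℕ) (τ : Traj S A H) (s : S) :
    0 ≤ M.nextState H τ s := by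
  cases H with
  | zero => exact M.ρ_nonneg s
  | succ H => exact M.P_nonneg _ _ s

lemma MDP.sum_nextState (M : MDP S A) (H : ℕ) (τ : Traj S A H) :
    ∑ s, M.nextState H τ s = 1 := by
  cases H with
  | zero => exact M.ρ_sum
  | succ H => exact M.P_sum _ _

lemma MDP.trajProb_succ (M : MDP S A) (π : S → A → ℝ) (H : ℕ) (τ : Traj S A (H + 1)) :
    M.trajProb π (H + 1) τ = M.trajProb π H (Fin.init τ) *
      (M.nextState H (Fin.init τ) (τ (Fin.last H)).1 *
        π (τ (Fin.last H)).1 (τ (Fin.last H)).2) := by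
  cases H with
  | zero => simp [MDP.trajProb, MDP.nextState]
  | succ H => rfl

lemma MDP.trajProb_snoc (M : MDP S A) (π : S → A → ℝ) (H : ℕ) (τ : Traj S A H) (x : S × A) :
    M.trajProb π (H + 1) (Fin.snoc τ x : Traj S A (H + 1)) =
      M.trajProb π H τ * (M.nextState H τ x.1 * π x.1 x.2) := by
  rw [M.trajProb_succ]
  simp

lemma MDP.trajProb_nonneg (M : MDP S A) {π : S → A → ℝ} (hπ : IsPolicy π) (H : ℕ)
    (τ : Traj S A H) : 0 ≤ M.trajProb π H τ := by
  induction H with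
  | zero => simp [MDP.trajProb]
  | succ H ih =>
    rw [M.trajProb_succ]
    exact mul_nonneg (ih _) (mul_nonneg (M.nextState_nonneg _ _ _) (hπ.1 _ _))

lemma MDP.sum_trajProb_succ_smul {E : Type*} [AddCommGroup E] [Module ℝ E] (M : MDP S A)
    (π : S → A → ℝ) (H : ℕ) (f : Traj S A (H + 1) → E) :
    ∑ τ, M.trajProb π (H + 1) τ • f τ =
      ∑ τ, M.trajProb π H τ • ∑ s, M.nextState H τ s • ∑ a, π s a •
        f (Fin.snoc τ (s, a) : Traj S A (H + 1)) := by
  rw [sum_fin_succ_snoc]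
  refine Finset.sum_congr rfl fun τ _ => ?_
  rw [Fintype.sum_prod_type, Finset.smul_sum]
  refine Finset.sum_congr rfl fun s _ => ?_
  rw [Finset.smul_sum, Finset.smul_sum]
  refine Finset.sum_congr rfl fun a _ => ?_
  rw [M.trajProb_snoc, smul_smul, smul_smul, mul_assoc]

/-- Functions of the first `H` steps have the same expectation under the longer chain. -/
lemma MDP.sum_trajProb_init {E : Type*} [AddCommGroup E] [Module ℝ E] (M : MDP S A)
    {π : S → A → ℝ} (hπ : IsPolicy π) (H : ℕ) (f : Traj S A H → E) :
    ∑ τ, M.trajProb π (H + 1) τ • f (Fin.init τ) = ∑ τ, M.trajProb π H τ • f τ := by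
  rw [M.sum_trajProb_succ_smul]
  simp only [Fin.init_snoc]
  simp [← Finset.sum_smul, hπ.2, M.sum_nextState]

lemma MDP.sum_trajProb (M : MDP S A) {π : S → A → ℝ} (hπ : IsPolicy π) (H : ℕ) :
    ∑ τ, M.trajProb π H τ = 1 := by
  induction H with
  | zero => simp [MDP.trajProb]
  | succ H ih => simpa [ih] using M.sum_trajProb_init hπ H (fun _ => (1 : ℝ))

/-- Appending one step to two chains with the same kernel adds at most `D` to the `ℓ¹` distance of
their laws: write `p'q' - pq = (p' - p)q' + p(q' - q)` and sum out the last step. -/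
lemma MDP.sum_abs_trajProb_sub_le (M : MDP S A) {π π' : S → A → ℝ} (hπ : IsPolicy π)
    (hπ' : IsPolicy π') {D : ℝ} (hD : ∀ s, ∑ a, |π' s a - π s a| ≤ D) (H : ℕ) :
    ∑ τ, |M.trajProb π' H τ - M.trajProb π H τ| ≤ H * D := by
  induction H with
  | zero => simp [MDP.trajProb]
  | succ H ih =>
    rw [sum_fin_succ_snoc]
    have key : ∀ τ : Traj S A H, ∑ x : S × A,
        |M.trajProb π' (H + 1) (Fin.snoc τ x : Traj S A (H + 1)) -
          M.trajProb π (H + 1) (Fin.snoc τ x : Traj S A (H + 1))| ≤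
        |M.trajProb π' H τ - M.trajProb π H τ| + M.trajProb π H τ * D := by
      intro τ
      have hb : ∀ x : S × A,
          |M.trajProb π' (H + 1) (Fin.snoc τ x : Traj S A (H + 1)) -
            M.trajProb π (H + 1) (Fin.snoc τ x : Traj S A (H + 1))| ≤
          |M.trajProb π' H τ - M.trajProb π H τ| * (M.nextState H τ x.1 * π' x.1 x.2) +
            M.trajProb π H τ * (M.nextState H τ x.1 * |π' x.1 x.2 - π x.1 x.2|) := by
        intro x
        rw [M.trajProb_snoc, M.trajProb_snoc]
        have h0 := M.nextState_nonneg H τ x.1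
        have h1 := hπ'.1 x.1 x.2
        have h2 := M.trajProb_nonneg hπ H τ
        calc _ = |(M.trajProb π' H τ - M.trajProb π H τ) * (M.nextState H τ x.1 * π' x.1 x.2) +
              M.trajProb π H τ * (M.nextState H τ x.1 * (π' x.1 x.2 - π x.1 x.2))| := by
              congr 1; ring
          _ ≤ _ := by
              refine (abs_add_le _ _).trans (le_of_eq ?_)
              rw [abs_mul, abs_mul, abs_mul, abs_mul, abs_of_nonneg h0, abs_of_nonneg h1,
                abs_of_nonneg h2]
      refine (Finset.sum_le_sum fun x _ => hb x).trans ?_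
      rw [Finset.sum_add_distrib, ← Finset.mul_sum, ← Finset.mul_sum, Fintype.sum_prod_type,
        Fintype.sum_prod_type]
      simp only [← Finset.mul_sum, hπ'.2, mul_one, M.sum_nextState]
      refine add_le_add le_rfl (mul_le_mul_of_nonneg_left ?_ (M.trajProb_nonneg hπ H τ))
      calc _ ≤ ∑ s, M.nextState H τ s * D := Finset.sum_le_sum fun s _ =>
            mul_le_mul_of_nonneg_left (hD s) (M.nextState_nonneg _ _ _)
        _ = D := by rw [← Finset.sum_mul, M.sum_nextState, one_mul]
    refine (Finset.sum_le_sum fun τ _ => key τ).trans ?_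
    rw [Finset.sum_add_distrib, ← Finset.sum_mul, M.sum_trajProb hπ]
    push_cast
    linarith

lemma sum_Ici_castSucc {E : Type*} [AddCommMonoid E] {H : ℕ} (t : Fin H) (f : Fin (H + 1) → E) :
    ∑ h ∈ Finset.Ici t.castSucc, f h = ∑ h ∈ Finset.Ici t, f h.castSucc + f (Fin.last H) := by
  have e : ∀ {n : ℕ} (t : Fin n) (f : Fin n → E),
      ∑ h ∈ Finset.Ici t, f h = ∑ h, if t ≤ h then f h else 0 := by
    intro n t f
    rw [← Finset.sum_filter]
    congr 1
    ext; simp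
  rw [e, e, Fin.sum_univ_castSucc]
  simp [Fin.le_last]

/-- Rewards collected before an action do not correlate with its centered score. -/
lemma MDP.sum_trajProb_return_smul_score {E : Type*} [AddCommGroup E] [Module ℝ E] (M : MDP S A)
    {π : S → A → ℝ} (hπ : IsPolicy π) (u : S × A → E) (hu : ∀ s, ∑ a, π s a • u (s, a) = 0)
    (c : ℕ → ℝ) (r : S × A → ℝ) (H : ℕ) :
    ∑ τ : Traj S A H, M.trajProb π H τ • ((∑ h : Fin H, c h * r (τ h)) • ∑ t, u (τ t)) =
      ∑ τ : Traj S A H, M.trajProb π H τ •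
        ∑ t : Fin H, (∑ h ∈ Finset.Ici t, c h * r (τ h)) • u (τ t) := by
  induction H with
  | zero => simp
  | succ H ih =>
    have h1 : ∀ τ : Traj S A (H + 1),
        (∑ h : Fin (H + 1), c h * r (τ h)) • ∑ t, u (τ t) =
          (∑ h : Fin H, c h * r (Fin.init τ h)) • ∑ t, u (Fin.init τ t) +
          (∑ h : Fin H, c h * r (Fin.init τ h)) • u (τ (Fin.last H)) +
          (c H * r (τ (Fin.last H))) • ∑ t, u (τ t) := by
      intro τ
      simp only [Fin.sum_univ_castSucc, Fin.init, Fin.val_castSucc, Fin.val_last]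
      module
    have h2 : ∀ τ : Traj S A (H + 1),
        ∑ t : Fin (H + 1), (∑ h ∈ Finset.Ici t, c h * r (τ h)) • u (τ t) =
          ∑ t : Fin H, (∑ h ∈ Finset.Ici t, c h * r (Fin.init τ h)) • u (Fin.init τ t) +
          (c H * r (τ (Fin.last H))) • ∑ t, u (τ t) := by
      intro τ
      have : Finset.Ici (Fin.last H) = {Fin.last H} := by
        ext x; simp [Fin.last_le_iff]
      simp only [Fin.sum_univ_castSucc, sum_Ici_castSucc, Fin.init, Fin.val_castSucc, Fin.val_last,
        add_smul, Finset.sum_add_distrib, smul_add, Finset.smul_sum, this, Finset.sum_singleton]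
      abel
    -- The earlier rewards are fixed by the first `H` steps, and the last score has conditional mean
    -- zero.
    have h3 : ∑ τ : Traj S A (H + 1), M.trajProb π (H + 1) τ •
        ((∑ h : Fin H, c h * r (Fin.init τ h)) • u (τ (Fin.last H))) = 0 := by
      rw [M.sum_trajProb_succ_smul]
      simp only [Fin.init_snoc, Fin.snoc_last]
      have : ∀ (x : ℝ) (s : S), ∑ a, π s a • x • u (s, a) = 0 := by
        intro x s
        simp_rw [smul_comm _ x]
        rw [← Finset.smul_sum, hu, smul_zero]
      simp [this]
    simp only [h1, h2, smul_add, Finset.sum_add_distrib]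
    rw [h3, M.sum_trajProb_init hπ H
      (fun τ => (∑ h : Fin H, c h * r (τ h)) • ∑ t, u (τ t)), ih,
      M.sum_trajProb_init hπ H
      (fun τ => ∑ t : Fin H, (∑ h ∈ Finset.Ici t, c h * r (τ h)) • u (τ t)), add_zero]

variable [DecidableEq S] [DecidableEq A] {d : ℕ}

/-! ### Taylor estimates from bounds on gradients. -/

section Gradient

variable {E : Type*} [NormedAddCommGroup E] [InnerProductSpace ℝ E] [CompleteSpace E]

lemma norm_fderiv_sub_fderiv (f : E → ℝ) (x y : E) :
    ‖fderiv ℝ f y - fderiv ℝ f x‖ = ‖gradient f y - gradient f x‖ := by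
  rw [← toDual_gradient, ← toDual_gradient, ← map_sub, LinearIsometryEquiv.norm_map]

lemma abs_sub_le_of_norm_gradient_le {f : E → ℝ} (hf : Differentiable ℝ f) {C : ℝ}
    (hC : ∀ x, ‖gradient f x‖ ≤ C) (x y : E) : |f y - f x| ≤ C * ‖y - x‖ := by
  refine Convex.norm_image_sub_le_of_norm_fderiv_le (𝕜 := ℝ) (s := Set.univ)
    (fun z _ => hf z) (fun z _ => ?_) convex_univ (Set.mem_univ _) (Set.mem_univ _)
  rw [← toDual_gradient, LinearIsometryEquiv.norm_map]
  exact hC z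

lemma abs_sub_sub_inner_gradient_le {f : E → ℝ} (hf : Differentiable ℝ f) {C : ℝ} (h0 : 0 ≤ C)
    (hC : ∀ x y, ‖gradient f y - gradient f x‖ ≤ C * ‖y - x‖) (x y : E) :
    |f y - f x - inner ℝ (gradient f x) (y - x)| ≤ C * ‖y - x‖ ^ 2 := by
  -- On the ball of radius `‖y - x‖` the derivative stays within `C * ‖y - x‖` of the one at `x`.
  -- This loses the factor `1/2`, which is harmless.
  have := Convex.norm_image_sub_le_of_norm_fderiv_le' (𝕜 := ℝ) (f := f)
    (s := Metric.closedBall x ‖y - x‖) (C := C * ‖y - x‖) (φ := fderiv ℝ f x)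
    (x := x) (y := y) (fun z _ => hf z) (fun z hz => ?_) (convex_closedBall _ _)
    (Metric.mem_closedBall_self (norm_nonneg _)) (by simp [dist_eq_norm])
  · rw [inner_gradient_left, pow_two, ← mul_assoc]
    exact this
  · rw [norm_fderiv_sub_fderiv]
    refine (hC _ _).trans (mul_le_mul_of_nonneg_left ?_ h0)
    simpa [dist_eq_norm] using hz

end Gradient

/-- The score `∇ log π_θ(a | s)`. -/
def score (ψ : S → A → Param d → ℝ) (θ : Param d) (x : S × A) : Param d :=
  gradient (fun ϑ => Real.log (softmax ψ ϑ x.1 x.2)) θ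

/-! ### Softmax policies: scores and importance weights. -/

section Softmax

variable [Nonempty A]

lemma sum_exp_pos (ψ : S → A → Param d → ℝ) (θ : Param d) (s : S) :
    0 < ∑ b, Real.exp (ψ s b θ) :=
  Finset.sum_pos (fun _ _ => Real.exp_pos _) Finset.univ_nonempty

lemma softmax_pos (ψ : S → A → Param d → ℝ) (θ : Param d) (s : S) (a : A) :
    0 < softmax ψ θ s a :=
  div_pos (Real.exp_pos _) (sum_exp_pos ψ θ s)

lemma isPolicy_softmax (ψ : S → A → Param d → ℝ) (θ : Param d) : IsPolicy (softmax ψ θ) := by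
  refine ⟨fun s a => (softmax_pos ψ θ s a).le, fun s => ?_⟩
  simp only [softmax]
  rw [← Finset.sum_div, div_self (sum_exp_pos ψ θ s).ne']

lemma log_softmax (ψ : S → A → Param d → ℝ) (θ : Param d) (s : S) (a : A) :
    Real.log (softmax ψ θ s a) = ψ s a θ - Real.log (∑ b, Real.exp (ψ s b θ)) := by
  rw [softmax, Real.log_div (Real.exp_pos _).ne' (sum_exp_pos ψ θ s).ne', Real.log_exp]

lemma hasGradientAt_log_softmax {ψ : S → A → Param d → ℝ}
    (hψ : ∀ s a, Differentiable ℝ (ψ s a)) (θ : Param d) (s : S) (a : A) :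
    HasGradientAt (fun ϑ => Real.log (softmax ψ ϑ s a))
      (gradient (ψ s a) θ - ∑ b, softmax ψ θ s b • gradient (ψ s b) θ) θ := by
  simp only [log_softmax]
  have h1 : ∀ b, HasFDerivAt (ψ s b) (fderiv ℝ (ψ s b) θ) θ := fun b => (hψ s b θ).hasFDerivAt
  have h2 := (h1 a).sub ((HasFDerivAt.fun_sum fun b (_ : b ∈ Finset.univ) => (h1 b).exp).log
    (sum_exp_pos ψ θ s).ne')
  have e : InnerProductSpace.toDual ℝ (Param d)
      (gradient (ψ s a) θ - ∑ b, softmax ψ θ s b • gradient (ψ s b) θ) =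
      fderiv ℝ (ψ s a) θ - (∑ b, Real.exp (ψ s b θ))⁻¹ •
        ∑ b, Real.exp (ψ s b θ) • fderiv ℝ (ψ s b) θ := by
    rw [map_sub, map_sum, toDual_gradient, Finset.smul_sum]
    congr 1
    refine Finset.sum_congr rfl fun b _ => ?_
    rw [map_smulₛₗ, toDual_gradient, smul_smul, softmax, div_eq_inv_mul]
    simp
  rw [hasGradientAt_iff_hasFDerivAt, e]
  exact h2

variable {ψ : S → A → Param d → ℝ} {N : ℝ}

lemma PolicyRegular.differentiable (hψ : PolicyRegular ψ N N) (s : S) (a : A) :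
    Differentiable ℝ (ψ s a) :=
  (hψ.contDiff s a).differentiable (by norm_num)

lemma score_eq (hψ : PolicyRegular ψ N N) (θ : Param d) (s : S) (a : A) :
    score ψ θ (s, a) = gradient (ψ s a) θ - ∑ b, softmax ψ θ s b • gradient (ψ s b) θ :=
  (hasGradientAt_log_softmax hψ.differentiable θ s a).gradient

lemma differentiable_log_softmax (hψ : PolicyRegular ψ N N) (s : S) (a : A) :
    Differentiable ℝ (fun ϑ => Real.log (softmax ψ ϑ s a)) := fun θ =>
  (hasGradientAt_log_softmax hψ.differentiable θ s a).differentiableAt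

lemma sum_softmax_smul_score (hψ : PolicyRegular ψ N N) (θ : Param d) (s : S) :
    ∑ a, softmax ψ θ s a • score ψ θ (s, a) = 0 := by
  simp only [score_eq hψ, smul_sub, Finset.sum_sub_distrib]
  rw [← Finset.sum_smul, (isPolicy_softmax ψ θ).2, one_smul, sub_self]

lemma norm_sum_smul_le {E : Type*} [SeminormedAddCommGroup E] [NormedSpace ℝ E] {ι : Type*}
    [Fintype ι] {p : ι → ℝ} {f : ι → E} {C : ℝ} (hf : ∀ i, ‖f i‖ ≤ C) :
    ‖∑ i, p i • f i‖ ≤ (∑ i, |p i|) * C := by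
  rw [Finset.sum_mul]
  refine norm_sum_le_of_le _ fun i _ => ?_
  rw [norm_smul, Real.norm_eq_abs]
  exact mul_le_mul_of_nonneg_left (hf i) (abs_nonneg _)

lemma norm_score_le (hψ : PolicyRegular ψ N N) (θ : Param d) (x : S × A) :
    ‖score ψ θ x‖ ≤ 2 * N := by
  obtain ⟨s, a⟩ := x
  rw [score_eq hψ]
  have h := norm_sum_smul_le (p := softmax ψ θ s) (hψ.grad_le s · θ)
  have h' : ∑ b, |softmax ψ θ s b| = 1 := by
    simp only [abs_of_pos (softmax_pos ψ θ s _), (isPolicy_softmax ψ θ).2]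
  rw [h', one_mul] at h
  linarith [norm_sub_le (gradient (ψ s a) θ) (∑ b, softmax ψ θ s b • gradient (ψ s b) θ),
    hψ.grad_le s a θ]

lemma abs_log_softmax_sub_le (hψ : PolicyRegular ψ N N) (θ θ' : Param d) (s : S) (a : A) :
    |Real.log (softmax ψ θ' s a) - Real.log (softmax ψ θ s a)| ≤ 2 * N * ‖θ' - θ‖ :=
  abs_sub_le_of_norm_gradient_le (differentiable_log_softmax hψ s a)
    (fun ϑ => norm_score_le hψ ϑ (s, a)) θ θ'

/-- For close parameters the probability ratio is near `1`, which gives a bound independent of the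
number of actions; for distant ones the trivial bound `2` is enough. -/
lemma sum_abs_softmax_sub_le (hψ : PolicyRegular ψ N N) (θ θ' : Param d) (s : S) :
    ∑ a, |softmax ψ θ' s a - softmax ψ θ s a| ≤ 4 * N * ‖θ' - θ‖ := by
  rcases le_or_gt (2 * N * ‖θ' - θ‖) 1 with h | h
  · have key : ∀ a, |softmax ψ θ' s a - softmax ψ θ s a| ≤
        softmax ψ θ s a * (4 * N * ‖θ' - θ‖) := by
      intro a
      have h1 := abs_log_softmax_sub_le hψ θ θ' s a
      have h2 := Real.abs_exp_sub_one_le (h1.trans h)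
      have hp := softmax_pos ψ θ s a
      rw [Real.exp_sub, Real.exp_log (softmax_pos ψ θ' s a), Real.exp_log hp] at h2
      have h3 : softmax ψ θ' s a - softmax ψ θ s a =
          softmax ψ θ s a * (softmax ψ θ' s a / softmax ψ θ s a - 1) := by
        field_simp
      rw [h3, abs_mul, abs_of_pos hp]
      exact mul_le_mul_of_nonneg_left (by linarith) hp.le
    refine (Finset.sum_le_sum fun a _ => key a).trans ?_
    rw [← Finset.sum_mul, (isPolicy_softmax ψ θ).2, one_mul]
  · have key : ∀ a, |softmax ψ θ' s a - softmax ψ θ s a| ≤ softmax ψ θ' s a + softmax ψ θ s a := by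
      intro a
      have := softmax_pos ψ θ s a
      have := softmax_pos ψ θ' s a
      rw [abs_le]
      constructor <;> linarith
    refine (Finset.sum_le_sum fun a _ => key a).trans ?_
    rw [Finset.sum_add_distrib, (isPolicy_softmax ψ θ).2, (isPolicy_softmax ψ θ').2]
    linarith

lemma norm_gradient_sub_le (hψ : PolicyRegular ψ N N) (θ θ' : Param d) (s : S) (a : A) :
    ‖gradient (ψ s a) θ' - gradient (ψ s a) θ‖ ≤ N * ‖θ' - θ‖ := by
  have h1 : Differentiable ℝ (gradient (ψ s a)) := by
    have h2 : Differentiable ℝ (fderiv ℝ (ψ s a)) :=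
      ((hψ.contDiff s a).fderiv_right (m := 1) (by norm_num)).differentiable (by norm_num)
    exact (LinearIsometryEquiv.differentiable _).comp h2
  exact Convex.norm_image_sub_le_of_norm_fderiv_le (𝕜 := ℝ) (s := Set.univ)
    (fun z _ => h1 z) (fun z _ => hψ.hess_le s a z) convex_univ (Set.mem_univ _) (Set.mem_univ _)

lemma norm_score_sub_le (hN : 1 ≤ N) (hψ : PolicyRegular ψ N N) (θ θ' : Param d) (x : S × A) :
    ‖score ψ θ' x - score ψ θ x‖ ≤ 6 * N ^ 2 * ‖θ' - θ‖ := by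
  obtain ⟨s, a⟩ := x
  rw [score_eq hψ, score_eq hψ]
  have h1 := norm_gradient_sub_le hψ θ θ' s a
  have h2 := norm_sum_smul_le (p := fun b => softmax ψ θ' s b - softmax ψ θ s b)
    (hψ.grad_le s · θ')
  have h3 := norm_sum_smul_le (p := softmax ψ θ s) (norm_gradient_sub_le hψ θ θ' s)
  have h4 : ∑ b, |softmax ψ θ s b| = 1 := by
    simp only [abs_of_pos (softmax_pos ψ θ s _), (isPolicy_softmax ψ θ).2]
  have h5 := mul_le_mul_of_nonneg_right (sum_abs_softmax_sub_le hψ θ θ' s)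
    (zero_le_one.trans hN)
  have h6 : N * ‖θ' - θ‖ ≤ N ^ 2 * ‖θ' - θ‖ :=
    mul_le_mul_of_nonneg_right (by nlinarith) (norm_nonneg _)
  rw [h4, one_mul] at h3
  -- The change of the averaged gradient is split into a change of the weights and a change of the
  -- gradients; the three pieces contribute `N`, `4N²` and `N`.
  have e : (gradient (ψ s a) θ' - ∑ b, softmax ψ θ' s b • gradient (ψ s b) θ') -
      (gradient (ψ s a) θ - ∑ b, softmax ψ θ s b • gradient (ψ s b) θ) =
      (gradient (ψ s a) θ' - gradient (ψ s a) θ) -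
      ∑ b, (softmax ψ θ' s b - softmax ψ θ s b) • gradient (ψ s b) θ' -
      ∑ b, softmax ψ θ s b • (gradient (ψ s b) θ' - gradient (ψ s b) θ) := by
    simp only [sub_smul, smul_sub, Finset.sum_sub_distrib]
    abel
  rw [e]
  refine (norm_sub_le _ _).trans ((add_le_add (norm_sub_le _ _) le_rfl).trans ?_)
  nlinarith

lemma abs_log_softmax_sub_sub_inner_le (hN : 1 ≤ N) (hψ : PolicyRegular ψ N N) (θ θ' : Param d)
    (x : S × A) :
    |Real.log (softmax ψ θ' x.1 x.2) - Real.log (softmax ψ θ x.1 x.2) -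
      inner ℝ (score ψ θ x) (θ' - θ)| ≤ 6 * N ^ 2 * ‖θ' - θ‖ ^ 2 :=
  abs_sub_sub_inner_gradient_le (differentiable_log_softmax hψ x.1 x.2) (by positivity)
    (fun ϑ ϑ' => norm_score_sub_le hN hψ ϑ ϑ' x) θ θ'

variable {H : ℕ}

lemma isWeight_eq_exp (ψ : S → A → Param d → ℝ) (τ : Traj S A H) (θ' θ : Param d) :
    isWeight ψ τ θ' θ = Real.exp (∑ h, (Real.log (softmax ψ θ' (τ h).1 (τ h).2) -
      Real.log (softmax ψ θ (τ h).1 (τ h).2))) := by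
  rw [Real.exp_sum, isWeight]
  refine Finset.prod_congr rfl fun h _ => ?_
  rw [Real.exp_sub, Real.exp_log (softmax_pos _ _ _ _), Real.exp_log (softmax_pos _ _ _ _)]

lemma abs_sum_log_softmax_sub_le (hN : 1 ≤ N) (hH : (H : ℝ) ≤ N) (hψ : PolicyRegular ψ N N)
    (τ : Traj S A H) (θ' θ : Param d) :
    |∑ h, (Real.log (softmax ψ θ' (τ h).1 (τ h).2) -
      Real.log (softmax ψ θ (τ h).1 (τ h).2))| ≤ 2 * N ^ 2 * ‖θ' - θ‖ := by
  refine (Finset.abs_sum_le_sum_abs _ _).trans ?_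
  refine (Finset.sum_le_sum fun h _ => abs_log_softmax_sub_le hψ θ θ' _ _).trans ?_
  rw [Finset.sum_const, Finset.card_univ, Fintype.card_fin, nsmul_eq_mul]
  have : 0 ≤ 2 * N * ‖θ' - θ‖ := by positivity
  nlinarith

/-- The logarithm of the weight is a sum of at most `N` increments, each at most `2N‖θ' - θ‖`, so a
short step controls the weight on every trajectory and not merely in mean square. -/
lemma abs_isWeight_sub_one_le (hN : 1 ≤ N) (hH : (H : ℝ) ≤ N) (hψ : PolicyRegular ψ N N)
    (τ : Traj S A H) {θ' θ : Param d} (h : 2 * N ^ 2 * ‖θ' - θ‖ ≤ 1) :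
    |isWeight ψ τ θ' θ - 1| ≤ 4 * N ^ 2 * ‖θ' - θ‖ := by
  rw [isWeight_eq_exp]
  have h1 := abs_sum_log_softmax_sub_le hN hH hψ τ θ' θ
  linarith [Real.abs_exp_sub_one_le (h1.trans h)]

lemma abs_isWeight_sub_one_sub_inner_le (hN : 1 ≤ N) (hH : (H : ℝ) ≤ N)
    (hψ : PolicyRegular ψ N N) (τ : Traj S A H) {θ' θ : Param d}
    (h : 2 * N ^ 2 * ‖θ' - θ‖ ≤ 1) :
    |isWeight ψ τ θ' θ - 1 - inner ℝ (∑ t, score ψ θ (τ t)) (θ' - θ)| ≤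
      10 * N ^ 4 * ‖θ' - θ‖ ^ 2 := by
  rw [isWeight_eq_exp]
  have h1 := abs_sum_log_softmax_sub_le hN hH hψ τ θ' θ
  have h2 := Real.abs_exp_sub_one_sub_id_le (h1.trans h)
  set X := ∑ h, (Real.log (softmax ψ θ' (τ h).1 (τ h).2) -
      Real.log (softmax ψ θ (τ h).1 (τ h).2)) with hX
  have h3 : |X - inner ℝ (∑ t, score ψ θ (τ t)) (θ' - θ)| ≤ N * (6 * N ^ 2 * ‖θ' - θ‖ ^ 2) := by
    rw [sum_inner, hX, ← Finset.sum_sub_distrib]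
    refine (Finset.abs_sum_le_sum_abs _ _).trans ?_
    refine (Finset.sum_le_sum fun h _ =>
      abs_log_softmax_sub_sub_inner_le hN hψ θ θ' (τ h)).trans ?_
    rw [Finset.sum_const, Finset.card_univ, Fintype.card_fin, nsmul_eq_mul]
    exact mul_le_mul_of_nonneg_right hH (by positivity)
  have h4 : X ^ 2 ≤ (2 * N ^ 2 * ‖θ' - θ‖) ^ 2 := sq_le_sq' (by linarith [neg_abs_le X])
    (by linarith [le_abs_self X])
  have h5 : N ^ 3 * ‖θ' - θ‖ ^ 2 ≤ N ^ 4 * ‖θ' - θ‖ ^ 2 :=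
    mul_le_mul_of_nonneg_right (pow_le_pow_right₀ hN (by norm_num)) (by positivity)
  calc _ = |(Real.exp X - 1 - X) + (X - inner ℝ (∑ t, score ψ θ (τ t)) (θ' - θ))| := by
        congr 1; ring
    _ ≤ _ := abs_add_le _ _
    _ ≤ _ := by nlinarith

/-- The transition probabilities are common to both laws. This change of measure makes the
correction terms of the algorithm unbiased, and it also underlies the first order expansion of the
occupancy measure. -/
lemma MDP.trajProb_mul_isWeight (M : MDP S A) (ψ : S → A → Param d → ℝ) (τ : Traj S A H)
    (θ' θ : Param d) :
    M.trajProb (softmax ψ θ) H τ * isWeight ψ τ θ' θ = M.trajProb (softmax ψ θ') H τ := by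
  induction H with
  | zero => simp [MDP.trajProb, isWeight]
  | succ H ih =>
    rw [M.trajProb_succ, M.trajProb_succ, ← ih (Fin.init τ), isWeight, isWeight,
      Fin.prod_univ_castSucc]
    have := (softmax_pos ψ θ (τ (Fin.last H)).1 (τ (Fin.last H)).2).ne'
    simp only [Fin.init]
    field_simp

end Softmax

/-! ### The `ℓ¹` norm and its duality with gradients bounded in the sup norm. -/

/-- The `ℓ¹` norm of a vector indexed by state-action pairs. -/
def l1 (v : SAVec S A) : ℝ := ∑ x, |v x|

lemma l1_nonneg (v : SAVec S A) : 0 ≤ l1 v := Finset.sum_nonneg fun _ _ => abs_nonneg _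

lemma l1_sub_le (v w : SAVec S A) : l1 (v - w) ≤ l1 v + l1 w := by
  rw [l1, l1, l1, ← Finset.sum_add_distrib]
  exact Finset.sum_le_sum fun x _ => abs_sub _ _

lemma l1_smul (c : ℝ) (v : SAVec S A) : l1 (c • v) = |c| * l1 v := by
  simp [l1, Finset.mul_sum, abs_mul]

lemma l1_sum_le {ι : Type*} (s : Finset ι) (v : ι → SAVec S A) :
    l1 (∑ i ∈ s, v i) ≤ ∑ i ∈ s, l1 (v i) := by
  simp only [l1]
  rw [Finset.sum_comm]
  refine Finset.sum_le_sum fun x _ => ?_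
  simp only [WithLp.ofLp_sum, Finset.sum_apply]
  exact Finset.abs_sum_le_sum_abs _ _

lemma norm_le_l1 (v : SAVec S A) : ‖v‖ ≤ l1 v := by
  rw [EuclideanSpace.norm_eq]
  refine Real.sqrt_le_iff.2 ⟨l1_nonneg v, ?_⟩
  simp only [Real.norm_eq_abs]
  exact Finset.sum_sq_le_sq_sum_of_nonneg fun _ _ => abs_nonneg _

lemma abs_inner_le_l1 {r : SAVec S A} {c : ℝ} (hr : ∀ i, |r i| ≤ c) (v : SAVec S A) :
    |inner ℝ r v| ≤ c * l1 v := by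
  rw [PiLp.inner_apply, l1, Finset.mul_sum]
  refine (Finset.abs_sum_le_sum_abs _ _).trans (Finset.sum_le_sum fun i _ => ?_)
  simp only [RCLike.inner_apply, conj_trivial]
  rw [abs_mul, mul_comm]
  exact mul_le_mul_of_nonneg_right (hr i) (abs_nonneg _)

section Utility

variable {F : SAVec S A → ℝ} {l L Linf : ℝ}

lemma UtilityRegular.exists_sub_eq_inner (hF : UtilityRegular F l L Linf) (μ ν : SAVec S A) :
    ∃ z ∈ segment ℝ ν μ, F μ - F ν = inner ℝ (gradient F z) (μ - ν) := by
  obtain ⟨z, hz, h⟩ := domain_mvt (f := F) (s := Set.univ) (x := ν) (y := μ)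
    (f' := fderiv ℝ F) (fun x _ => (hF.differentiable x).hasFDerivAt.hasFDerivWithinAt)
    convex_univ (Set.mem_univ _) (Set.mem_univ _)
  exact ⟨z, hz, by rw [h, inner_gradient_left]⟩

lemma UtilityRegular.abs_sub_le (hF : UtilityRegular F l L Linf) (μ ν : SAVec S A) :
    |F μ - F ν| ≤ l * l1 (μ - ν) := by
  obtain ⟨z, -, h⟩ := hF.exists_sub_eq_inner μ ν
  rw [h]
  exact abs_inner_le_l1 (hF.grad_le z) _

lemma UtilityRegular.abs_sub_sub_inner_le (hF : UtilityRegular F l L Linf) (hL : 0 ≤ Linf)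
    (μ ν : SAVec S A) :
    |F μ - F ν - inner ℝ (gradient F ν) (μ - ν)| ≤ Linf * l1 (μ - ν) ^ 2 := by
  obtain ⟨z, hz, h⟩ := hF.exists_sub_eq_inner μ ν
  rw [h, ← inner_sub_left, pow_two, ← mul_assoc]
  refine abs_inner_le_l1 (fun i => (hF.grad_lip_one z ν i).trans ?_) _
  rw [segment_eq_image'] at hz
  obtain ⟨t, ⟨ht0, ht1⟩, rfl⟩ := hz
  refine mul_le_mul_of_nonneg_left (Finset.sum_le_sum fun j _ => ?_) hL
  simp only [PiLp.add_apply, PiLp.smul_apply, PiLp.sub_apply, smul_eq_mul, add_sub_cancel_left]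
  rw [abs_mul, abs_of_nonneg ht0]
  exact mul_le_of_le_one_left (abs_nonneg _) ht1

end Utility

/-! ### Occupancy measures and their truncation. -/

section StateAction

variable (M : MDP S A) {π π' : S → A → ℝ}

lemma MDP.saProb_nonneg (hπ : IsPolicy π) (t : ℕ) (x : S × A) : 0 ≤ M.saProb π t x := by
  refine Finset.sum_nonneg fun τ _ => ?_
  split_ifs
  exacts [M.trajProb_nonneg hπ _ _, le_rfl]

lemma MDP.sum_saProb (hπ : IsPolicy π) (t : ℕ) : ∑ x, M.saProb π t x = 1 := by
  simp only [MDP.saProb]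
  rw [Finset.sum_comm]
  simp [M.sum_trajProb hπ]

lemma MDP.saProb_le_one (hπ : IsPolicy π) (t : ℕ) (x : S × A) : M.saProb π t x ≤ 1 := by
  rw [← M.sum_saProb hπ t]
  exact Finset.single_le_sum (fun y _ => M.saProb_nonneg hπ t y) (Finset.mem_univ x)

lemma MDP.sum_abs_saProb (hπ : IsPolicy π) (t : ℕ) : ∑ x, |M.saProb π t x| = 1 := by
  simp only [abs_of_nonneg (M.saProb_nonneg hπ t _), M.sum_saProb hπ]

lemma MDP.sum_abs_saProb_sub_le (hπ : IsPolicy π) (hπ' : IsPolicy π') {D : ℝ}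
    (hD : ∀ s, ∑ a, |π' s a - π s a| ≤ D) (t : ℕ) :
    ∑ x, |M.saProb π' t x - M.saProb π t x| ≤ (t + 1) * D := by
  have h := M.sum_abs_trajProb_sub_le hπ hπ' hD (t + 1)
  push_cast at h
  refine le_trans ?_ h
  have key : ∀ x, |M.saProb π' t x - M.saProb π t x| ≤ ∑ τ : Traj S A (t + 1),
      if τ (Fin.last t) = x then |M.trajProb π' (t + 1) τ - M.trajProb π (t + 1) τ| else 0 := by
    intro x
    rw [MDP.saProb, MDP.saProb, ← Finset.sum_sub_distrib]
    refine (Finset.abs_sum_le_sum_abs _ _).trans (Finset.sum_le_sum fun τ _ => ?_)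
    split_ifs <;> simp
  refine (Finset.sum_le_sum fun x _ => key x).trans (le_of_eq ?_)
  rw [Finset.sum_comm]
  simp

/-- The expected truncated occupancy measure. -/
def MDP.truncOcc (γ : ℝ) (π : S → A → ℝ) (H : ℕ) : SAVec S A :=
  ∑ τ, M.trajProb π H τ • occEst γ τ

lemma occEst_succ (γ : ℝ) {H : ℕ} (τ : Traj S A (H + 1)) :
    occEst γ τ = occEst γ (Fin.init τ) + γ ^ H • EuclideanSpace.single (τ (Fin.last H)) 1 := by
  rw [occEst, Fin.sum_univ_castSucc]
  rfl

lemma MDP.truncOcc_apply (γ : ℝ) (hπ : IsPolicy π) (H : ℕ) (x : S × A) :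
    M.truncOcc γ π H x = ∑ t ∈ Finset.range H, γ ^ t * M.saProb π t x := by
  induction H with
  | zero => simp [MDP.truncOcc, occEst]
  | succ H ih =>
    have h : M.truncOcc γ π (H + 1) = M.truncOcc γ π H +
        γ ^ H • ∑ τ : Traj S A (H + 1), M.trajProb π (H + 1) τ •
          EuclideanSpace.single (τ (Fin.last H)) (1 : ℝ) := by
      simp only [MDP.truncOcc, occEst_succ, smul_add, Finset.sum_add_distrib]
      rw [M.sum_trajProb_init hπ H (occEst γ), Finset.smul_sum]
      simp only [smul_comm (γ ^ H)]
    rw [Finset.sum_range_succ, ← ih, h]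
    simp [MDP.saProb, Finset.sum_apply, Pi.single_apply, eq_comm]

lemma sum_abs_tsum_le {X : Type*} [Fintype X] {f : ℕ → X → ℝ} {b : ℕ → ℝ} {B : ℝ}
    (hb : HasSum b B) (h : ∀ t, ∑ x, |f t x| ≤ b t) : ∑ x, |∑' t, f t x| ≤ B := by
  have hs : ∀ x, Summable fun t => |f t x| := fun x =>
    Summable.of_nonneg_of_le (fun t => abs_nonneg _)
      (fun t => (Finset.single_le_sum (f := fun x => |f t x|) (fun _ _ => abs_nonneg _)
        (Finset.mem_univ x)).trans (h t)) hb.summable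
  calc _ ≤ ∑ x, ∑' t, |f t x| := Finset.sum_le_sum fun x _ => by
        simpa [Real.norm_eq_abs] using norm_tsum_le_tsum_norm (f := fun t => f t x)
          (by simpa [Real.norm_eq_abs] using hs x)
    _ = ∑' t, ∑ x, |f t x| := (Summable.tsum_finsetSum fun x _ => hs x).symm
    _ ≤ ∑' t, b t := Summable.tsum_le_tsum h (summable_sum fun x _ => hs x) hb.summable
    _ = B := hb.tsum_eq

variable {γ : ℝ}

lemma MDP.summable_saProb (hγ0 : 0 < γ) (hγ1 : γ < 1) (hπ : IsPolicy π) (x : S × A) :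
    Summable fun t => γ ^ t * M.saProb π t x :=
  Summable.of_nonneg_of_le (fun t => mul_nonneg (pow_nonneg hγ0.le t) (M.saProb_nonneg hπ t x))
    (fun t => mul_le_of_le_one_right (pow_nonneg hγ0.le t) (M.saProb_le_one hπ t x))
    (summable_geometric_of_lt_one hγ0.le hγ1)

lemma MDP.occupancy_sub_truncOcc_apply (hγ0 : 0 < γ) (hγ1 : γ < 1) (hπ : IsPolicy π) (H : ℕ)
    (x : S × A) :
    (M.occupancy γ π - M.truncOcc γ π H) x =
      ∑' t, γ ^ (t + H) * M.saProb π (t + H) x := by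
  have h := (M.summable_saProb hγ0 hγ1 hπ x).sum_add_tsum_nat_add H
  rw [PiLp.sub_apply, M.truncOcc_apply γ hπ]
  simp only [MDP.occupancy]
  linarith

lemma MDP.truncOcc_zero (γ : ℝ) (π : S → A → ℝ) : M.truncOcc γ π 0 = 0 := by
  simp [MDP.truncOcc, occEst]

lemma MDP.l1_occupancy_sub_truncOcc_le (hγ0 : 0 < γ) (hγ1 : γ < 1) (hπ : IsPolicy π) (H : ℕ) :
    l1 (M.occupancy γ π - M.truncOcc γ π H) ≤ γ ^ H * (1 - γ)⁻¹ := by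
  simp only [l1, M.occupancy_sub_truncOcc_apply hγ0 hγ1 hπ]
  refine sum_abs_tsum_le ((hasSum_geometric_of_lt_one hγ0.le hγ1).mul_left (γ ^ H)) fun t => ?_
  simp only [abs_mul, ← Finset.mul_sum, M.sum_abs_saProb hπ, mul_one]
  rw [abs_of_nonneg (by positivity), pow_add, mul_comm]

lemma MDP.l1_occupancy_le (hγ0 : 0 < γ) (hγ1 : γ < 1) (hπ : IsPolicy π) :
    l1 (M.occupancy γ π) ≤ (1 - γ)⁻¹ := by
  simpa [M.truncOcc_zero] using M.l1_occupancy_sub_truncOcc_le hγ0 hγ1 hπ 0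

lemma hasSum_geometric_mul_add (hγ0 : 0 < γ) (hγ1 : γ < 1) (c : ℝ) :
    HasSum (fun t : ℕ => γ ^ t * ((t : ℝ) + 1 + c)) ((1 - γ)⁻¹ ^ 2 + c * (1 - γ)⁻¹) := by
  have h1 := hasSum_coe_mul_geometric_of_norm_lt_one (𝕜 := ℝ) (r := γ)
    (by rwa [Real.norm_eq_abs, abs_of_pos hγ0])
  have h2 := (hasSum_geometric_of_lt_one hγ0.le hγ1).mul_left (1 + c)
  have h3 : (1 - γ) ≠ 0 := by linarith
  have e1 : (fun t : ℕ => γ ^ t * ((t : ℝ) + 1 + c)) =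
      fun t : ℕ => (t : ℝ) * γ ^ t + (1 + c) * γ ^ t := by
    funext t; ring
  have e2 : (1 - γ)⁻¹ ^ 2 + c * (1 - γ)⁻¹ = γ / (1 - γ) ^ 2 + (1 + c) * (1 - γ)⁻¹ := by
    field_simp; ring
  rw [e1, e2]
  exact h1.add h2

lemma MDP.l1_occupancy_tail_sub_le (hγ0 : 0 < γ) (hγ1 : γ < 1) (hπ : IsPolicy π)
    (hπ' : IsPolicy π') {D : ℝ} (hD : ∀ s, ∑ a, |π' s a - π s a| ≤ D) (H : ℕ) :
    l1 ((M.occupancy γ π' - M.truncOcc γ π' H) - (M.occupancy γ π - M.truncOcc γ π H)) ≤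
      γ ^ H * D * ((1 - γ)⁻¹ ^ 2 + H * (1 - γ)⁻¹) := by
  have e : ∀ x, ((M.occupancy γ π' - M.truncOcc γ π' H) -
      (M.occupancy γ π - M.truncOcc γ π H)) x =
      ∑' t, γ ^ (t + H) * (M.saProb π' (t + H) x - M.saProb π (t + H) x) := by
    intro x
    have hs : ∀ {π : S → A → ℝ}, IsPolicy π →
        Summable fun t => γ ^ (t + H) * M.saProb π (t + H) x := fun hπ =>
      (summable_nat_add_iff (f := fun t => γ ^ t * M.saProb _ t x) H).2 (M.summable_saProb hγ0 hγ1 hπ x)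
    rw [PiLp.sub_apply, M.occupancy_sub_truncOcc_apply hγ0 hγ1 hπ,
      M.occupancy_sub_truncOcc_apply hγ0 hγ1 hπ', ← (hs hπ').tsum_sub (hs hπ)]
    simp only [mul_sub]
  simp only [l1, e]
  refine sum_abs_tsum_le ((hasSum_geometric_mul_add hγ0 hγ1 H).mul_left (γ ^ H * D)) fun t => ?_
  simp only [abs_mul, ← Finset.mul_sum]
  have h := M.sum_abs_saProb_sub_le hπ hπ' hD (t + H)
  rw [abs_of_nonneg (by positivity : 0 ≤ γ ^ (t + H))]
  refine (mul_le_mul_of_nonneg_left h (by positivity)).trans (le_of_eq ?_)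
  push_cast
  ring

end StateAction

/-! ### First order expansion of the utility in the parameter. -/

section Softmax

variable [Nonempty A] (M : MDP S A) {ψ : S → A → Param d → ℝ} {γ N : ℝ} {H : ℕ}

/-- The tail is Lipschitz in `θ` with a constant of order `γ ^ H`. The factor `‖θ' - θ‖` is
essential: one-step errors are later divided by a contraction rate proportional to the step size. -/
lemma MDP.l1_occ_tail_sub_le (hγ0 : 0 < γ) (hγ1 : γ < 1) (hγN : (1 - γ)⁻¹ ≤ N)
    (hH : (H : ℝ) ≤ N) (hψ : PolicyRegular ψ N N) (θ' θ : Param d) :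
    l1 ((occ M γ ψ θ' - M.truncOcc γ (softmax ψ θ') H) -
      (occ M γ ψ θ - M.truncOcc γ (softmax ψ θ) H)) ≤ 8 * N ^ 3 * γ ^ H * ‖θ' - θ‖ := by
  have h := M.l1_occupancy_tail_sub_le hγ0 hγ1 (isPolicy_softmax ψ θ) (isPolicy_softmax ψ θ')
    (sum_abs_softmax_sub_le hψ θ θ') H
  refine h.trans ?_
  have h0 : 0 < (1 - γ)⁻¹ := inv_pos.2 (by linarith)
  have h1 : (1 - γ)⁻¹ ^ 2 + H * (1 - γ)⁻¹ ≤ 2 * N ^ 2 := by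
    have := pow_le_pow_left₀ h0.le hγN 2
    have := mul_le_mul hH hγN h0.le ((Nat.cast_nonneg H).trans hH)
    nlinarith
  have hN : 0 ≤ N := h0.le.trans hγN
  refine (mul_le_mul_of_nonneg_left h1 (by positivity)).trans (le_of_eq ?_)
  ring

lemma MDP.l1_occ_sub_le (hγ0 : 0 < γ) (hγ1 : γ < 1) (hγN : (1 - γ)⁻¹ ≤ N)
    (hψ : PolicyRegular ψ N N) (θ' θ : Param d) :
    l1 (occ M γ ψ θ' - occ M γ ψ θ) ≤ 4 * N ^ 3 * ‖θ' - θ‖ := by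
  have h := M.l1_occupancy_tail_sub_le hγ0 hγ1 (isPolicy_softmax ψ θ) (isPolicy_softmax ψ θ')
    (sum_abs_softmax_sub_le hψ θ θ') 0
  simp only [M.truncOcc_zero, sub_zero, pow_zero, one_mul, Nat.cast_zero, zero_mul,
    add_zero] at h
  have h0 : 0 < (1 - γ)⁻¹ := inv_pos.2 (by linarith)
  have hN : 0 ≤ N := h0.le.trans hγN
  refine h.trans ((mul_le_mul_of_nonneg_left (pow_le_pow_left₀ h0.le hγN 2)
    (by positivity)).trans (le_of_eq ?_))
  ring

lemma l1_occEst_le (hγ0 : 0 < γ) (hγ1 : γ < 1) (hH : (H : ℝ) ≤ N) (τ : Traj S A H) :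
    l1 (occEst γ τ) ≤ N := by
  refine (l1_sum_le _ _).trans ?_
  have h : ∀ h : Fin H, l1 (γ ^ (h : ℕ) • EuclideanSpace.single (τ h) (1 : ℝ)) ≤ 1 := by
    intro h
    have : l1 (EuclideanSpace.single (τ h) (1 : ℝ)) = 1 := by
      simp [l1, apply_ite abs]
    rw [l1_smul, this, mul_one, abs_of_nonneg (by positivity)]
    exact pow_le_one₀ hγ0.le hγ1.le
  refine (Finset.sum_le_sum fun i _ => h i).trans ?_
  simpa using hH

lemma MDP.l1_truncOcc_sub_le (hγ0 : 0 < γ) (hγ1 : γ < 1) (hN : 1 ≤ N) (hH : (H : ℝ) ≤ N)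
    (hψ : PolicyRegular ψ N N) (θ' θ : Param d) :
    l1 (M.truncOcc γ (softmax ψ θ') H - M.truncOcc γ (softmax ψ θ) H) ≤
      4 * N ^ 3 * ‖θ' - θ‖ := by
  have h := M.sum_abs_trajProb_sub_le (isPolicy_softmax ψ θ) (isPolicy_softmax ψ θ')
    (sum_abs_softmax_sub_le hψ θ θ') H
  rw [MDP.truncOcc, MDP.truncOcc, ← Finset.sum_sub_distrib]
  simp only [← sub_smul]
  refine (l1_sum_le _ _).trans ?_
  simp only [l1_smul]
  refine (Finset.sum_le_sum fun τ _ => mul_le_mul_of_nonneg_left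
    (l1_occEst_le hγ0 hγ1 hH τ) (abs_nonneg _)).trans ?_
  rw [← Finset.sum_mul]
  have h1 : (H : ℝ) * (4 * N * ‖θ' - θ‖) ≤ N * (4 * N * ‖θ' - θ‖) :=
    mul_le_mul_of_nonneg_right hH (by positivity)
  refine (mul_le_mul_of_nonneg_right (h.trans h1) (by positivity)).trans (le_of_eq ?_)
  ring

/-- The expectation of the truncated policy gradient estimate. -/
def MDP.meanGrad (γ : ℝ) (ψ : S → A → Param d → ℝ) (H : ℕ) (θ : Param d) (r : SAVec S A) :
    Param d :=
  ∑ τ : Traj S A H, M.trajProb (softmax ψ θ) H τ • pgEst γ ψ τ θ r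

lemma inner_occEst (r : SAVec S A) (τ : Traj S A H) :
    inner ℝ r (occEst γ τ) = ∑ h : Fin H, γ ^ (h : ℕ) * r (τ h) := by
  rw [occEst, inner_sum]
  refine Finset.sum_congr rfl fun h _ => ?_
  rw [inner_smul_right, EuclideanSpace.inner_single_right]
  simp

/-- In expectation the rewards to go may be replaced by the whole return, since the scores are
centred. The total score appearing here is the linear part of the importance weight. -/
lemma MDP.meanGrad_eq (hψ : PolicyRegular ψ N N) (θ : Param d) (r : SAVec S A) :
    M.meanGrad γ ψ H θ r = ∑ τ : Traj S A H, M.trajProb (softmax ψ θ) H τ •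
      (inner ℝ r (occEst γ τ) • ∑ t, score ψ θ (τ t)) := by
  simp only [inner_occEst]
  exact (M.sum_trajProb_return_smul_score (isPolicy_softmax ψ θ) (score ψ θ)
    (sum_softmax_smul_score hψ θ) (fun h => γ ^ h) (fun x => r x) H).symm

/-- Both terms are expectations under `θ`: the increment of the truncated occupancy measure carries
the factor `w - 1`, the gradient term its linear part. The remainder is the second order error of
the weight times a return of size at most `N²`. -/
lemma MDP.abs_inner_truncOcc_sub_sub_le (hγ0 : 0 < γ) (hγ1 : γ < 1) (hN : 1 ≤ N)
    (hH : (H : ℝ) ≤ N) (hψ : PolicyRegular ψ N N) {θ' θ : Param d}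
    (h : 2 * N ^ 2 * ‖θ' - θ‖ ≤ 1) {r : SAVec S A} (hr : ∀ i, |r i| ≤ N) :
    |inner ℝ r (M.truncOcc γ (softmax ψ θ') H - M.truncOcc γ (softmax ψ θ) H) -
      inner ℝ (M.meanGrad γ ψ H θ r) (θ' - θ)| ≤ 10 * N ^ 6 * ‖θ' - θ‖ ^ 2 := by
  have e : inner ℝ r (M.truncOcc γ (softmax ψ θ') H - M.truncOcc γ (softmax ψ θ) H) -
      inner ℝ (M.meanGrad γ ψ H θ r) (θ' - θ) =
      ∑ τ : Traj S A H, M.trajProb (softmax ψ θ) H τ * (inner ℝ r (occEst γ τ) *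
        (isWeight ψ τ θ' θ - 1 - inner ℝ (∑ t, score ψ θ (τ t)) (θ' - θ))) := by
    rw [M.meanGrad_eq hψ, MDP.truncOcc, MDP.truncOcc, inner_sub_right, inner_sum, inner_sum,
      sum_inner, ← Finset.sum_sub_distrib, ← Finset.sum_sub_distrib]
    refine Finset.sum_congr rfl fun τ _ => ?_
    rw [inner_smul_right, inner_smul_right, real_inner_smul_left, real_inner_smul_left,
      ← M.trajProb_mul_isWeight ψ τ θ' θ]
    ring
  rw [e]
  refine (Finset.abs_sum_le_sum_abs _ _).trans ?_
  have key : ∀ τ : Traj S A H, |M.trajProb (softmax ψ θ) H τ * (inner ℝ r (occEst γ τ) *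
        (isWeight ψ τ θ' θ - 1 - inner ℝ (∑ t, score ψ θ (τ t)) (θ' - θ)))| ≤
      M.trajProb (softmax ψ θ) H τ * (10 * N ^ 6 * ‖θ' - θ‖ ^ 2) := by
    intro τ
    have hp := M.trajProb_nonneg (isPolicy_softmax ψ θ) H τ
    rw [abs_mul, abs_of_nonneg hp, abs_mul]
    refine mul_le_mul_of_nonneg_left ?_ hp
    have h1 : |inner ℝ r (occEst γ τ)| ≤ N ^ 2 := by
      refine (abs_inner_le_l1 hr _).trans ?_
      rw [pow_two]
      exact mul_le_mul_of_nonneg_left (l1_occEst_le hγ0 hγ1 hH τ) (by linarith)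
    refine (mul_le_mul h1 (abs_isWeight_sub_one_sub_inner_le hN hH hψ τ h) (abs_nonneg _)
      (by positivity)).trans (le_of_eq ?_)
    ring
  refine (Finset.sum_le_sum fun τ _ => key τ).trans (le_of_eq ?_)
  rw [← Finset.sum_mul, M.sum_trajProb (isPolicy_softmax ψ θ), one_mul]

/-- First order expansion of the utility with the truncated gradient at an inexact reward. -/
lemma MDP.abs_utility_sub_sub_inner_meanGrad_le (hγ0 : 0 < γ) (hγ1 : γ < 1) (hN : 1 ≤ N)
    (hγN : (1 - γ)⁻¹ ≤ N) (hH : (H : ℝ) ≤ N) (hψ : PolicyRegular ψ N N)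
    {F : SAVec S A → ℝ} (hF : UtilityRegular F N N N) {θ' θ : Param d}
    (h : 2 * N ^ 2 * ‖θ' - θ‖ ≤ 1) {r : SAVec S A} (hr : ∀ i, |r i| ≤ N) {σ : ℝ}
    (hσ : ∀ i, |gradient F (occ M γ ψ θ) i - r i| ≤ σ) :
    |F (occ M γ ψ θ') - F (occ M γ ψ θ) - inner ℝ (M.meanGrad γ ψ H θ r) (θ' - θ)| ≤
      (8 * N ^ 4 * γ ^ H + 4 * N ^ 3 * σ) * ‖θ' - θ‖ + 26 * N ^ 7 * ‖θ' - θ‖ ^ 2 := by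
  set x := ‖θ' - θ‖ with hx
  set g := gradient F (occ M γ ψ θ)
  have hx0 : 0 ≤ x := norm_nonneg _
  have hN0 : 0 ≤ N := by linarith
  have h1 := hF.abs_sub_sub_inner_le hN0 (occ M γ ψ θ') (occ M γ ψ θ)
  have h2 := M.l1_occ_sub_le hγ0 hγ1 hγN hψ θ' θ
  have h3 := mul_le_mul_of_nonneg_left (pow_le_pow_left₀ (l1_nonneg _) h2 2) hN0
  have h4 := (abs_inner_le_l1 (hF.grad_le (occ M γ ψ θ)) _).trans
    (mul_le_mul_of_nonneg_left (M.l1_occ_tail_sub_le hγ0 hγ1 hγN hH hψ θ' θ) hN0)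
  have h6 : |inner ℝ (g - r) (M.truncOcc γ (softmax ψ θ') H - M.truncOcc γ (softmax ψ θ) H)| ≤
      σ * (4 * N ^ 3 * x) := by
    -- An index is needed to deduce `0 ≤ σ`; without one there would be no states, contradicting the
    -- total mass of `ρ`.
    rcases isEmpty_or_nonempty (S × A) with hE | ⟨⟨i⟩⟩
    · have : g - r = 0 := by ext i; exact hE.elim i
      rw [this, inner_zero_left, abs_zero]
      have hS : IsEmpty S := ⟨fun s => hE.elim (s, Classical.arbitrary A)⟩
      exact absurd M.ρ_sum (by simp)
    · have hσ0 : 0 ≤ σ := (abs_nonneg _).trans (hσ i)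
      exact (abs_inner_le_l1 hσ _).trans (mul_le_mul_of_nonneg_left
        (M.l1_truncOcc_sub_le hγ0 hγ1 hN hH hψ θ' θ) hσ0)
  have h7 := M.abs_inner_truncOcc_sub_sub_le hγ0 hγ1 hN hH hψ h hr
  have h8 : N ^ 6 * x ^ 2 ≤ N ^ 7 * x ^ 2 :=
    mul_le_mul_of_nonneg_right (pow_le_pow_right₀ hN (by norm_num)) (by positivity)
  -- Four errors: the curvature of `F`, the truncated tail, the inexact reward, and the
  -- linearization of the weights.
  have e : F (occ M γ ψ θ') - F (occ M γ ψ θ) - inner ℝ (M.meanGrad γ ψ H θ r) (θ' - θ) =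
      (F (occ M γ ψ θ') - F (occ M γ ψ θ) - inner ℝ g (occ M γ ψ θ' - occ M γ ψ θ)) +
      inner ℝ g ((occ M γ ψ θ' - M.truncOcc γ (softmax ψ θ') H) -
        (occ M γ ψ θ - M.truncOcc γ (softmax ψ θ) H)) +
      inner ℝ (g - r) (M.truncOcc γ (softmax ψ θ') H - M.truncOcc γ (softmax ψ θ) H) +
      (inner ℝ r (M.truncOcc γ (softmax ψ θ') H - M.truncOcc γ (softmax ψ θ) H) -
        inner ℝ (M.meanGrad γ ψ H θ r) (θ' - θ)) := by
    simp only [inner_sub_left, inner_sub_right]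
    ring
  rw [e]
  refine (abs_add_le _ _).trans ((add_le_add ((abs_add_le _ _).trans
    (add_le_add (abs_add_le _ _) le_rfl)) le_rfl).trans ?_)
  nlinarith

end Softmax

/-! ### One iteration: sure bounds and conditional variance. -/

lemma norm_normStep_sub_le {α : ℝ} (hα : 0 ≤ α) (θ v : Param d) : ‖normStep α θ v - θ‖ ≤ α := by
  rw [normStep, add_sub_cancel_left, norm_smul, norm_div, norm_norm, Real.norm_eq_abs,
    abs_of_nonneg hα]
  rcases eq_or_ne ‖v‖ 0 with h | h
  · simpa [h] using hα
  · rw [div_mul_cancel₀ _ h]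

lemma inner_normStep_sub (α : ℝ) (θ v : Param d) :
    inner ℝ v (normStep α θ v - θ) = α * ‖v‖ := by
  rw [normStep, add_sub_cancel_left, inner_smul_right, real_inner_self_eq_norm_sq]
  rcases eq_or_ne ‖v‖ 0 with h | h
  · simp [h]
  · field_simp

/-- The cross term with the centred noise vanishes, and the variance is at most the second moment.
-/
lemma sum_mul_norm_add_sub_sq_le {ι E : Type*} [Fintype ι] [NormedAddCommGroup E]
    [InnerProductSpace ℝ E] {p : ι → ℝ} (hp : ∀ i, 0 ≤ p i) (hp1 : ∑ i, p i = 1) {Y : ι → E}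
    {b : ℝ} (hY : ∀ i, ‖Y i‖ ≤ b) (e : E) :
    ∑ i, p i * ‖e + (Y i - ∑ j, p j • Y j)‖ ^ 2 ≤ ‖e‖ ^ 2 + b ^ 2 := by
  set m := ∑ j, p j • Y j with hm
  have h1 : ∀ i, p i * ‖e + (Y i - m)‖ ^ 2 =
      p i * ‖e - m‖ ^ 2 + 2 * inner ℝ (e - m) (p i • Y i) + p i * ‖Y i‖ ^ 2 := by
    intro i
    rw [show e + (Y i - m) = (e - m) + Y i by abel, norm_add_sq_real, inner_smul_right]
    ring
  have h2 : ∑ i, p i * ‖Y i‖ ^ 2 ≤ b ^ 2 := by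
    calc _ ≤ ∑ i, p i * b ^ 2 := Finset.sum_le_sum fun i _ =>
          mul_le_mul_of_nonneg_left (pow_le_pow_left₀ (norm_nonneg _) (hY i) 2) (hp i)
      _ = b ^ 2 := by rw [← Finset.sum_mul, hp1, one_mul]
  simp only [h1, Finset.sum_add_distrib]
  rw [← Finset.sum_mul, hp1, one_mul, ← Finset.mul_sum, ← inner_sum, ← hm, norm_sub_sq_real,
    inner_sub_left, real_inner_self_eq_norm_sq]
  nlinarith [sq_nonneg ‖m‖]

lemma etaSeq_pos (t : ℕ) : 0 < etaSeq t := by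
  rw [etaSeq]; positivity

lemma etaSeq_succ_le_one (t : ℕ) : etaSeq (t + 1) ≤ 1 := by
  rw [etaSeq, div_le_one (by positivity)]
  push_cast
  linarith [(Nat.cast_nonneg t : (0 : ℝ) ≤ t)]

/-- Bounds on the variables of the algorithm that hold along every run after iteration `n`. -/
structure State.Bounded (F : SAVec S A → ℝ) (N α : ℝ) (n : ℕ) (s : State S A d) : Prop where
  dist_le : ‖s.θ - s.θprev‖ ≤ α
  r_eq : s.r = gradient F s.lam
  rprev_le : ∀ i, |s.rprev i| ≤ N
  -- The corrections `(1 - w) • occEst` may accumulate, hence the linear growth. It is harmless,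
  -- because this norm enters the next increment multiplied by `etaSeq (n + 1)`, and `etaSeq (n + 1)
  -- * n ≤ 2`.
  lam_le : ‖s.lam‖ ≤ N + 4 * N ^ 3 * α * n
  r_sub_le : 1 ≤ n → ∀ i, |s.r i - s.rprev i| ≤ N * (2 * N * etaSeq n + 12 * N ^ 3 * α)

section Step

variable [Nonempty A] {M : MDP S A} {ψ : S → A → Param d → ℝ} {F : SAVec S A → ℝ}
  {γ N α : ℝ} {H n : ℕ} {s : State S A d}

lemma norm_occEst_le (hγ0 : 0 < γ) (hγ1 : γ < 1) (hH : (H : ℝ) ≤ N) (τ : Traj S A H) :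
    ‖occEst γ τ‖ ≤ N :=
  (norm_le_l1 _).trans (l1_occEst_le hγ0 hγ1 hH τ)

lemma abs_sum_Ici_le (hγ0 : 0 < γ) (hγ1 : γ < 1) (hH : (H : ℝ) ≤ N)
    {r : SAVec S A} {c : ℝ} (hc : 0 ≤ c) (hr : ∀ i, |r i| ≤ c) (τ : Traj S A H) (t : Fin H) :
    |∑ h ∈ Finset.Ici t, γ ^ (h : ℕ) * r (τ h)| ≤ N * c := by
  refine (Finset.abs_sum_le_sum_abs _ _).trans ?_
  calc _ ≤ ∑ h ∈ Finset.Ici t, c := Finset.sum_le_sum fun h _ => by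
        rw [abs_mul, abs_of_nonneg (by positivity)]
        exact (mul_le_of_le_one_left (abs_nonneg _) (pow_le_one₀ hγ0.le hγ1.le)).trans (hr _)
    _ ≤ ∑ h : Fin H, c := Finset.sum_le_sum_of_subset_of_nonneg (Finset.subset_univ _)
        fun _ _ _ => hc
    _ = H * c := by simp
    _ ≤ N * c := mul_le_mul_of_nonneg_right hH hc

lemma norm_pgEst_le (hγ0 : 0 < γ) (hγ1 : γ < 1) (hN : 1 ≤ N) (hH : (H : ℝ) ≤ N)
    (hψ : PolicyRegular ψ N N) {r : SAVec S A} (hr : ∀ i, |r i| ≤ N) (τ : Traj S A H)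
    (θ : Param d) : ‖pgEst γ ψ τ θ r‖ ≤ 2 * N ^ 4 := by
  have h : ∀ t : Fin H, ‖(∑ h ∈ Finset.Ici t, γ ^ (h : ℕ) * r (τ h)) • score ψ θ (τ t)‖ ≤
      2 * N ^ 3 := by
    intro t
    rw [norm_smul, Real.norm_eq_abs]
    refine (mul_le_mul (abs_sum_Ici_le hγ0 hγ1 hH (by linarith) hr τ t)
      (norm_score_le hψ θ (τ t)) (norm_nonneg _) (by positivity)).trans (le_of_eq ?_)
    ring
  refine (norm_sum_le_of_le _ fun t _ => h t).trans ?_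
  rw [Finset.sum_const, Finset.card_univ, Fintype.card_fin, nsmul_eq_mul]
  refine (mul_le_mul_of_nonneg_right hH (by positivity)).trans (le_of_eq ?_)
  ring

lemma norm_pgEst_sub_le (hγ0 : 0 < γ) (hγ1 : γ < 1) (hN : 1 ≤ N) (hH : (H : ℝ) ≤ N)
    (hψ : PolicyRegular ψ N N) {r r' : SAVec S A} (hr : ∀ i, |r i| ≤ N) {c : ℝ} (hc : 0 ≤ c)
    (hrr : ∀ i, |r' i - r i| ≤ c) (τ : Traj S A H) (θ' θ : Param d) :
    ‖pgEst γ ψ τ θ' r' - pgEst γ ψ τ θ r‖ ≤ 2 * N ^ 3 * c + 6 * N ^ 5 * ‖θ' - θ‖ := by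
  have e : pgEst γ ψ τ θ' r' - pgEst γ ψ τ θ r =
      ∑ t : Fin H, ((∑ h ∈ Finset.Ici t, γ ^ (h : ℕ) * (r' - r) (τ h)) • score ψ θ' (τ t) +
      (∑ h ∈ Finset.Ici t, γ ^ (h : ℕ) * r (τ h)) •
        (score ψ θ' (τ t) - score ψ θ (τ t))) := by
    simp only [pgEst, ← Finset.sum_sub_distrib]
    refine Finset.sum_congr rfl fun t _ => ?_
    simp only [PiLp.sub_apply, mul_sub, Finset.sum_sub_distrib, score]
    module
  have h : ∀ t : Fin H, ‖(∑ h ∈ Finset.Ici t, γ ^ (h : ℕ) * (r' - r) (τ h)) • score ψ θ' (τ t) +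
      (∑ h ∈ Finset.Ici t, γ ^ (h : ℕ) * r (τ h)) • (score ψ θ' (τ t) - score ψ θ (τ t))‖ ≤
      2 * N ^ 2 * c + 6 * N ^ 4 * ‖θ' - θ‖ := by
    intro t
    refine (norm_add_le _ _).trans ?_
    rw [norm_smul, norm_smul, Real.norm_eq_abs, Real.norm_eq_abs]
    refine (add_le_add (mul_le_mul (abs_sum_Ici_le (r := r' - r) hγ0 hγ1 hH hc hrr τ t)
      (norm_score_le hψ θ' (τ t)) (norm_nonneg _) (by positivity))
      (mul_le_mul (abs_sum_Ici_le hγ0 hγ1 hH (by linarith) hr τ t)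
      (norm_score_sub_le hN hψ θ θ' (τ t)) (norm_nonneg _) (by positivity))).trans (le_of_eq ?_)
    ring
  rw [e]
  refine (norm_sum_le_of_le _ fun t _ => h t).trans ?_
  rw [Finset.sum_const, Finset.card_univ, Fintype.card_fin, nsmul_eq_mul]
  refine (mul_le_mul_of_nonneg_right hH (by positivity)).trans (le_of_eq ?_)
  ring

lemma bounded_step_zero (hγ0 : 0 < γ) (hγ1 : γ < 1) (hH : (H : ℝ) ≤ N)
    (hF : UtilityRegular F N N N) (hα : 0 ≤ α) (τ : Traj S A H) :
    (step γ ψ F etaSeq (fun _ => α) 0 s τ).Bounded F N α 0 where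
  dist_le := norm_normStep_sub_le hα _ _
  r_eq := rfl
  rprev_le := hF.grad_le _
  lam_le := by simpa [step] using norm_occEst_le hγ0 hγ1 hH τ
  r_sub_le := by simp

/-- The part of the new occupancy estimate that depends on the trajectory. -/
def lamIncr (γ : ℝ) (ψ : S → A → Param d → ℝ) (η : ℝ) (s : State S A d) (τ : Traj S A H) :
    SAVec S A :=
  occEst γ τ - (1 - η) • isWeight ψ τ s.θprev s.θ • occEst γ τ

/-- The part of the new direction that depends on the trajectory. -/
def dirIncr (γ : ℝ) (ψ : S → A → Param d → ℝ) (η : ℝ) (s : State S A d) (τ : Traj S A H) :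
    Param d :=
  pgEst γ ψ τ s.θ s.r - (1 - η) • isWeight ψ τ s.θprev s.θ • pgEst γ ψ τ s.θprev s.rprev

lemma step_succ_lam (η α : ℕ → ℝ) (τ : Traj S A H) :
    (step γ ψ F η α (n + 1) s τ).lam =
      (1 - η (n + 1)) • s.lam + lamIncr γ ψ (η (n + 1)) s τ := by
  simp only [step, lamIncr]
  module

lemma step_succ_dir (η α : ℕ → ℝ) (τ : Traj S A H) :
    (step γ ψ F η α (n + 1) s τ).dir =
      (1 - η (n + 1)) • s.dir + dirIncr γ ψ (η (n + 1)) s τ := by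
  simp only [step, dirIncr]
  module

/-- Reweighting turns the correction into an expectation at the previous parameter, so the
conditional means telescope against the targets in `errLam`. -/
lemma sum_trajProb_smul_lamIncr (η : ℝ) :
    ∑ τ : Traj S A H, M.trajProb (softmax ψ s.θ) H τ • lamIncr γ ψ η s τ =
      M.truncOcc γ (softmax ψ s.θ) H - (1 - η) • M.truncOcc γ (softmax ψ s.θprev) H := by
  simp only [lamIncr, smul_sub, Finset.sum_sub_distrib, MDP.truncOcc, Finset.smul_sum]
  congr 1
  refine Finset.sum_congr rfl fun τ _ => ?_
  rw [← M.trajProb_mul_isWeight ψ τ s.θprev s.θ]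
  module

/-- Both reward vectors are determined before the current trajectory is drawn; this is why the
direction uses the rewards of earlier iterations. -/
lemma sum_trajProb_smul_dirIncr (η : ℝ) :
    ∑ τ : Traj S A H, M.trajProb (softmax ψ s.θ) H τ • dirIncr γ ψ η s τ =
      M.meanGrad γ ψ H s.θ s.r - (1 - η) • M.meanGrad γ ψ H s.θprev s.rprev := by
  simp only [dirIncr, smul_sub, Finset.sum_sub_distrib, MDP.meanGrad, Finset.smul_sum]
  congr 1
  refine Finset.sum_congr rfl fun τ _ => ?_
  rw [← M.trajProb_mul_isWeight ψ τ s.θprev s.θ]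
  module

lemma State.Bounded.abs_one_sub_isWeight_le (hs : s.Bounded F N α n) (hN : 1 ≤ N)
    (hH : (H : ℝ) ≤ N) (hψ : PolicyRegular ψ N N) (hα : 2 * N ^ 2 * α ≤ 1) (τ : Traj S A H) :
    |1 - isWeight ψ τ s.θprev s.θ| ≤ 4 * N ^ 2 * α := by
  have h : ‖s.θprev - s.θ‖ ≤ α := by rw [norm_sub_rev]; exact hs.dist_le
  rw [abs_sub_comm]
  exact (abs_isWeight_sub_one_le hN hH hψ τ
    ((mul_le_mul_of_nonneg_left h (by positivity)).trans hα)).trans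
    (mul_le_mul_of_nonneg_left h (by positivity))

lemma State.Bounded.norm_lamIncr_le (hs : s.Bounded F N α n) (hγ0 : 0 < γ) (hγ1 : γ < 1)
    (hN : 1 ≤ N) (hH : (H : ℝ) ≤ N) (hψ : PolicyRegular ψ N N) (hα : 2 * N ^ 2 * α ≤ 1)
    {η : ℝ} (hη0 : 0 ≤ η) (hη1 : η ≤ 1) (τ : Traj S A H) :
    ‖lamIncr γ ψ η s τ‖ ≤ N * η + 4 * N ^ 3 * α := by
  have hw := hs.abs_one_sub_isWeight_le hN hH hψ hα τ
  set w := isWeight ψ τ s.θprev s.θ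
  have e : lamIncr γ ψ η s τ = (η + (1 - η) * (1 - w)) • occEst γ τ := by
    simp only [lamIncr]
    module
  have h1 : |η + (1 - η) * (1 - w)| ≤ η + 4 * N ^ 2 * α := by
    refine (abs_add_le _ _).trans ?_
    rw [abs_of_nonneg hη0, abs_mul, abs_of_nonneg (by linarith : 0 ≤ 1 - η)]
    linarith [mul_le_of_le_one_left (abs_nonneg (1 - w)) (by linarith : 1 - η ≤ 1)]
  rw [e, norm_smul, Real.norm_eq_abs]
  refine (mul_le_mul h1 (norm_occEst_le hγ0 hγ1 hH τ) (norm_nonneg _)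
    ((abs_nonneg _).trans h1)).trans (le_of_eq ?_)
  ring

lemma etaSeq_le_two_mul_succ (hn : 1 ≤ n) : etaSeq n ≤ 2 * etaSeq (n + 1) := by
  have : (1 : ℝ) ≤ n := by exact_mod_cast hn
  simp only [etaSeq]
  push_cast
  rw [mul_div_assoc', div_le_div_iff₀ (by positivity) (by positivity)]
  nlinarith

lemma etaSeq_succ_mul_le (n : ℕ) : etaSeq (n + 1) * n ≤ 2 := by
  simp only [etaSeq]
  push_cast
  rw [div_mul_eq_mul_div, div_le_iff₀ (by positivity)]
  linarith

lemma State.Bounded.step_succ (hs : s.Bounded F N α n) (hγ0 : 0 < γ) (hγ1 : γ < 1)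
    (hN : 1 ≤ N) (hH : (H : ℝ) ≤ N) (hψ : PolicyRegular ψ N N) (hF : UtilityRegular F N N N)
    (hα0 : 0 ≤ α) (hα : 2 * N ^ 2 * α ≤ 1) (τ : Traj S A H) :
    (step γ ψ F etaSeq (fun _ => α) (n + 1) s τ).Bounded F N α (n + 1) := by
  have hη0 := (etaSeq_pos (n + 1)).le
  have hη1 := etaSeq_succ_le_one n
  have hY := hs.norm_lamIncr_le hγ0 hγ1 hN hH hψ hα hη0 hη1 τ
  have hlam := hs.lam_le
  have hηn := etaSeq_succ_mul_le n
  set η := etaSeq (n + 1) with hη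
  have h3 : 0 ≤ 4 * N ^ 3 * α := by positivity
  constructor
  · exact norm_normStep_sub_le hα0 _ _
  · rfl
  · intro i
    change |s.r i| ≤ N
    rw [hs.r_eq]
    exact hF.grad_le _ i
  · rw [step_succ_lam]
    refine (norm_add_le _ _).trans ?_
    rw [norm_smul, Real.norm_eq_abs, abs_of_nonneg (by linarith)]
    have h1 := mul_le_mul_of_nonneg_left hlam (by linarith : 0 ≤ 1 - η)
    have h2 : (1 - η) * (4 * N ^ 3 * α * n) ≤ 4 * N ^ 3 * α * n :=
      mul_le_of_le_one_left (by positivity) (by linarith)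
    push_cast
    nlinarith
  · intro _ i
    change |gradient F (step γ ψ F etaSeq (fun _ => α) (n + 1) s τ).lam i - s.r i| ≤ _
    rw [hs.r_eq]
    refine (hF.grad_lip _ _ i).trans (mul_le_mul_of_nonneg_left ?_ (by linarith))
    have e : (step γ ψ F etaSeq (fun _ => α) (n + 1) s τ).lam - s.lam =
        lamIncr γ ψ η s τ - η • s.lam := by
      rw [step_succ_lam]
      module
    rw [e]
    refine (norm_sub_le _ _).trans ?_
    rw [norm_smul, Real.norm_eq_abs, abs_of_nonneg hη0]
    have h1 := mul_le_mul_of_nonneg_left hlam hη0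
    have h2 : 4 * N ^ 3 * α * (η * n) ≤ 4 * N ^ 3 * α * 2 := mul_le_mul_of_nonneg_left hηn h3
    nlinarith

/-- The two gradient estimates share one trajectory and differ only through the parameter, the
reward and the weight, all of which move by `O(η + α)`. The increment is therefore small itself, not
only its mean. -/
lemma State.Bounded.norm_dirIncr_le (hs : s.Bounded F N α n) (hγ0 : 0 < γ) (hγ1 : γ < 1)
    (hN : 1 ≤ N) (hH : (H : ℝ) ≤ N) (hψ : PolicyRegular ψ N N) (hF : UtilityRegular F N N N)
    (hα0 : 0 ≤ α) (hα : 2 * N ^ 2 * α ≤ 1) (τ : Traj S A H) :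
    ‖dirIncr γ ψ (etaSeq (n + 1)) s τ‖ ≤ 10 * N ^ 5 * etaSeq (n + 1) + 38 * N ^ 7 * α := by
  have hη0 := (etaSeq_pos (n + 1)).le
  have hη1 := etaSeq_succ_le_one n
  have hw := hs.abs_one_sub_isWeight_le hN hH hψ hα τ
  have hr : ∀ i, |s.r i| ≤ N := by rw [hs.r_eq]; exact hF.grad_le _
  have hg := norm_pgEst_le hγ0 hγ1 hN hH hψ hr τ s.θ
  have hg' := norm_pgEst_le hγ0 hγ1 hN hH hψ hs.rprev_le τ s.θprev
  have p4 : N ^ 4 ≤ N ^ 5 := pow_le_pow_right₀ hN (by norm_num)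
  have p5 : N ^ 5 * α ≤ N ^ 7 * α :=
    mul_le_mul_of_nonneg_right (pow_le_pow_right₀ hN (by norm_num)) hα0
  have p6 : N ^ 6 * α ≤ N ^ 7 * α :=
    mul_le_mul_of_nonneg_right (pow_le_pow_right₀ hN (by norm_num)) hα0
  have q7 : 0 ≤ N ^ 7 * α := by positivity
  -- At the first correction `etaSeq 1 = 1`, so the old gradient estimate drops out and the reward
  -- difference, controlled only for `1 ≤ n`, is not needed.
  rcases Nat.eq_zero_or_pos n with rfl | hn
  · have h1 : etaSeq (0 + 1) = 1 := by norm_num [etaSeq]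
    rw [h1, dirIncr, sub_self, zero_smul, sub_zero]
    nlinarith
  · have hηη := etaSeq_le_two_mul_succ hn
    set η := etaSeq (n + 1) with hη
    set w := isWeight ψ τ s.θprev s.θ
    set g := pgEst γ ψ τ s.θ s.r
    set g' := pgEst γ ψ τ s.θprev s.rprev
    have hc : ∀ i, |s.r i - s.rprev i| ≤ N * (4 * N * η + 12 * N ^ 3 * α) := fun i =>
      (hs.r_sub_le hn i).trans (mul_le_mul_of_nonneg_left (by nlinarith) (by linarith))
    have hd : ‖g - g'‖ ≤ 8 * N ^ 5 * η + 30 * N ^ 7 * α := by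
      refine (norm_pgEst_sub_le hγ0 hγ1 hN hH hψ hs.rprev_le (by positivity) hc τ s.θ
        s.θprev).trans ?_
      have := mul_le_mul_of_nonneg_left hs.dist_le (by positivity : 0 ≤ 6 * N ^ 5)
      nlinarith
    have e : dirIncr γ ψ η s τ = η • g + (1 - η) • (g - g') + ((1 - η) * (1 - w)) • g' := by
      simp only [dirIncr]
      module
    have h1 : |(1 - η) * (1 - w)| ≤ 4 * N ^ 2 * α := by
      rw [abs_mul, abs_of_nonneg (by linarith : 0 ≤ 1 - η)]
      linarith [mul_le_of_le_one_left (abs_nonneg (1 - w)) (by linarith : 1 - η ≤ 1)]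
    rw [e]
    refine (norm_add₃_le).trans ?_
    rw [norm_smul, norm_smul, norm_smul, Real.norm_eq_abs, Real.norm_eq_abs, Real.norm_eq_abs,
      abs_of_nonneg hη0, abs_of_nonneg (by linarith : 0 ≤ 1 - η)]
    have k1 := mul_le_mul_of_nonneg_left hg hη0
    have k2 : (1 - η) * ‖g - g'‖ ≤ ‖g - g'‖ :=
      mul_le_of_le_one_left (norm_nonneg _) (by linarith)
    have k3 := mul_le_mul h1 hg' (norm_nonneg _) (by positivity)
    have k4 := mul_le_mul_of_nonneg_left p4 hη0
    nlinarith

/-- The error of the occupancy estimate. -/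
def errLam (M : MDP S A) (γ : ℝ) (ψ : S → A → Param d → ℝ) (H : ℕ) (s : State S A d) : ℝ :=
  ‖s.lam - M.truncOcc γ (softmax ψ s.θprev) H‖

/-- The error of the direction as an estimate of the truncated policy gradient. -/
def errDir (M : MDP S A) (γ : ℝ) (ψ : S → A → Param d → ℝ) (H : ℕ) (s : State S A d) : ℝ :=
  ‖s.dir - M.meanGrad γ ψ H s.θprev s.rprev‖

/-- The new error is `1 - η` times the old one plus centred noise. The noise bound is weakened to
that of `dirIncr`, so that both errors satisfy the same recursion. -/
lemma State.Bounded.sum_errLam_sq_le (hs : s.Bounded F N α n) (hγ0 : 0 < γ) (hγ1 : γ < 1)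
    (hN : 1 ≤ N) (hH : (H : ℝ) ≤ N) (hψ : PolicyRegular ψ N N) (hα0 : 0 ≤ α)
    (hα : 2 * N ^ 2 * α ≤ 1) :
    ∑ τ : Traj S A H, M.trajProb (softmax ψ s.θ) H τ *
        errLam M γ ψ H (step γ ψ F etaSeq (fun _ => α) (n + 1) s τ) ^ 2 ≤
      (1 - etaSeq (n + 1)) ^ 2 * errLam M γ ψ H s ^ 2 +
        (10 * N ^ 5 * etaSeq (n + 1) + 38 * N ^ 7 * α) ^ 2 := by
  have hη0 := (etaSeq_pos (n + 1)).le
  have hπ := isPolicy_softmax ψ s.θ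
  have hb : ∀ τ : Traj S A H, ‖lamIncr γ ψ (etaSeq (n + 1)) s τ‖ ≤
      10 * N ^ 5 * etaSeq (n + 1) + 38 * N ^ 7 * α := by
    intro τ
    refine (hs.norm_lamIncr_le hγ0 hγ1 hN hH hψ hα hη0 (etaSeq_succ_le_one n) τ).trans ?_
    have p1 : N ≤ N ^ 5 := le_self_pow₀ hN (by norm_num)
    have p3 : N ^ 3 * α ≤ N ^ 7 * α :=
      mul_le_mul_of_nonneg_right (pow_le_pow_right₀ hN (by norm_num)) hα0
    have q7 : 0 ≤ N ^ 7 * α := by positivity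
    have q5 : 0 ≤ N ^ 5 * etaSeq (n + 1) := by positivity
    have := mul_le_mul_of_nonneg_right p1 hη0
    nlinarith
  have h := sum_mul_norm_add_sub_sq_le (M.trajProb_nonneg hπ H) (M.sum_trajProb hπ H) hb
    ((1 - etaSeq (n + 1)) • (s.lam - M.truncOcc γ (softmax ψ s.θprev) H))
  rw [norm_smul, mul_pow, Real.norm_eq_abs, sq_abs] at h
  refine le_trans (le_of_eq ?_) h
  refine Finset.sum_congr rfl fun τ _ => ?_
  rw [errLam, step_succ_lam, sum_trajProb_smul_lamIncr]
  change _ * ‖_ - M.truncOcc γ (softmax ψ s.θ) H‖ ^ 2 = _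
  congr 3
  module

lemma State.Bounded.sum_errDir_sq_le (hs : s.Bounded F N α n) (hγ0 : 0 < γ) (hγ1 : γ < 1)
    (hN : 1 ≤ N) (hH : (H : ℝ) ≤ N) (hψ : PolicyRegular ψ N N) (hF : UtilityRegular F N N N)
    (hα0 : 0 ≤ α) (hα : 2 * N ^ 2 * α ≤ 1) :
    ∑ τ : Traj S A H, M.trajProb (softmax ψ s.θ) H τ *
        errDir M γ ψ H (step γ ψ F etaSeq (fun _ => α) (n + 1) s τ) ^ 2 ≤
      (1 - etaSeq (n + 1)) ^ 2 * errDir M γ ψ H s ^ 2 +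
        (10 * N ^ 5 * etaSeq (n + 1) + 38 * N ^ 7 * α) ^ 2 := by
  have hπ := isPolicy_softmax ψ s.θ
  have h := sum_mul_norm_add_sub_sq_le (M.trajProb_nonneg hπ H) (M.sum_trajProb hπ H)
    (hs.norm_dirIncr_le hγ0 hγ1 hN hH hψ hF hα0 hα)
    ((1 - etaSeq (n + 1)) • (s.dir - M.meanGrad γ ψ H s.θprev s.rprev))
  rw [norm_smul, mul_pow, Real.norm_eq_abs, sq_abs] at h
  refine le_trans (le_of_eq ?_) h
  refine Finset.sum_congr rfl fun τ _ => ?_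
  rw [errDir, step_succ_dir, sum_trajProb_smul_dirIncr]
  change _ * ‖_ - M.meanGrad γ ψ H s.θ s.r‖ ^ 2 = _
  congr 3
  module

end Step

/-! ### Expectations along the run and decay of the estimation errors. -/

/-- The expectation of a function of the state of the algorithm after `n` trajectories, for a
constant step size. -/
def expect (M : MDP S A) (γ : ℝ) (ψ : S → A → Param d → ℝ) (F : SAVec S A → ℝ) (α : ℝ) (H : ℕ)
    (θ₀ : Param d) (n : ℕ) (f : State S A d → ℝ) : ℝ :=
  ∑ ω : Fin n → Traj S A H, runProb M γ ψ F etaSeq (fun _ => α) H θ₀ n ω *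
    f (run γ ψ F etaSeq (fun _ => α) H θ₀ n ω)

section Expect

variable [Nonempty A] {M : MDP S A} {ψ : S → A → Param d → ℝ} {F : SAVec S A → ℝ}
  {γ N α : ℝ} {H : ℕ} {θ₀ : Param d}

lemma runProb_nonneg (η α : ℕ → ℝ) (n : ℕ) (ω : Fin n → Traj S A H) :
    0 ≤ runProb M γ ψ F η α H θ₀ n ω := by
  induction n with
  | zero => simp [runProb]
  | succ n ih => exact mul_nonneg (ih _) (M.trajProb_nonneg (isPolicy_softmax ψ _) H _)

lemma expect_succ (n : ℕ) (f : State S A d → ℝ) :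
    expect M γ ψ F α H θ₀ (n + 1) f = ∑ ω : Fin n → Traj S A H,
      runProb M γ ψ F etaSeq (fun _ => α) H θ₀ n ω *
        ∑ τ : Traj S A H, M.trajProb (softmax ψ (run γ ψ F etaSeq (fun _ => α) H θ₀ n ω).θ) H τ *
          f (step γ ψ F etaSeq (fun _ => α) n (run γ ψ F etaSeq (fun _ => α) H θ₀ n ω) τ) := by
  rw [expect, sum_fin_succ_snoc]
  refine Finset.sum_congr rfl fun ω _ => ?_
  rw [Finset.mul_sum]
  refine Finset.sum_congr rfl fun τ _ => ?_
  simp only [runProb, run, Fin.init_snoc, Fin.snoc_last, mul_assoc]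

lemma expect_const (n : ℕ) (c : ℝ) : expect M γ ψ F α H θ₀ n (fun _ => c) = c := by
  induction n with
  | zero => simp [expect, runProb]
  | succ n ih =>
    have h : ∀ θ, ∑ τ, M.trajProb (softmax ψ θ) H τ * c = c := fun θ => by
      rw [← Finset.sum_mul, M.sum_trajProb (isPolicy_softmax ψ θ), one_mul]
    rw [expect_succ]
    simp only [h]
    exact ih

lemma expect_add (n : ℕ) (f g : State S A d → ℝ) :
    expect M γ ψ F α H θ₀ n (fun s => f s + g s) =
      expect M γ ψ F α H θ₀ n f + expect M γ ψ F α H θ₀ n g := by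
  simp only [expect, mul_add, Finset.sum_add_distrib]

lemma expect_const_mul (n : ℕ) (c : ℝ) (f : State S A d → ℝ) :
    expect M γ ψ F α H θ₀ n (fun s => c * f s) = c * expect M γ ψ F α H θ₀ n f := by
  simp only [expect, Finset.mul_sum]
  exact Finset.sum_congr rfl fun _ _ => by ring

lemma expect_mono (n : ℕ) {f g : State S A d → ℝ} (h : ∀ s, f s ≤ g s) :
    expect M γ ψ F α H θ₀ n f ≤ expect M γ ψ F α H θ₀ n g :=
  Finset.sum_le_sum fun _ _ => mul_le_mul_of_nonneg_left (h _) (runProb_nonneg _ _ _ _)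

lemma expect_nonneg (n : ℕ) {f : State S A d → ℝ} (h : ∀ s, 0 ≤ f s) :
    0 ≤ expect M γ ψ F α H θ₀ n f := by
  rw [← expect_const (M := M) (γ := γ) (ψ := ψ) (F := F) (α := α) (H := H) (θ₀ := θ₀) n 0]
  exact expect_mono n h

/-- Only histories of positive probability matter, since the iterates are known to lie in `Θ` only
almost surely. -/
lemma expect_succ_le_expect {n : ℕ} {f g : State S A d → ℝ}
    (h : ∀ ω, 0 < runProb M γ ψ F etaSeq (fun _ => α) H θ₀ n ω →
      ∑ τ : Traj S A H, M.trajProb (softmax ψ (run γ ψ F etaSeq (fun _ => α) H θ₀ n ω).θ) H τ *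
        f (step γ ψ F etaSeq (fun _ => α) n (run γ ψ F etaSeq (fun _ => α) H θ₀ n ω) τ) ≤
      g (run γ ψ F etaSeq (fun _ => α) H θ₀ n ω)) :
    expect M γ ψ F α H θ₀ (n + 1) f ≤ expect M γ ψ F α H θ₀ n g := by
  rw [expect_succ]
  refine Finset.sum_le_sum fun ω _ => ?_
  rcases (runProb_nonneg (M := M) (γ := γ) (ψ := ψ) (F := F) (θ₀ := θ₀) etaSeq
    (fun _ => α) n ω).eq_or_lt with h0 | h0
  · rw [← h0, zero_mul, zero_mul]
  · exact mul_le_mul_of_nonneg_left (h ω h0) h0.le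

/-- Jensen's inequality in the form `f ≤ f² / (2c) + c / 2`. -/
lemma expect_le_of_expect_sq_le {n : ℕ} {f : State S A d → ℝ} {c : ℝ} (hc : 0 < c)
    (h : expect M γ ψ F α H θ₀ n (fun s => f s ^ 2) ≤ c ^ 2) :
    expect M γ ψ F α H θ₀ n f ≤ c := by
  have h1 : ∀ s, f s ≤ (2 * c)⁻¹ * f s ^ 2 + c / 2 := by
    intro s
    have : (2 * c)⁻¹ * f s ^ 2 + c / 2 - f s = (f s - c) ^ 2 / (2 * c) := by
      field_simp; ring
    have h2 : 0 ≤ (f s - c) ^ 2 / (2 * c) := by positivity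
    linarith
  refine (expect_mono n h1).trans ?_
  rw [expect_add, expect_const_mul, expect_const]
  have h2 := mul_le_mul_of_nonneg_left h (by positivity : 0 ≤ (2 * c)⁻¹)
  have h3 : (2 * c)⁻¹ * c ^ 2 = c / 2 := by field_simp
  linarith

lemma bounded_run (hγ0 : 0 < γ) (hγ1 : γ < 1) (hN : 1 ≤ N) (hH : (H : ℝ) ≤ N)
    (hψ : PolicyRegular ψ N N) (hF : UtilityRegular F N N N) (hα0 : 0 ≤ α)
    (hα : 2 * N ^ 2 * α ≤ 1) (n : ℕ) (ω : Fin (n + 1) → Traj S A H) :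
    (run γ ψ F etaSeq (fun _ => α) H θ₀ (n + 1) ω).Bounded F N α n := by
  induction n with
  | zero => exact bounded_step_zero hγ0 hγ1 hH hF hα0 _
  | succ n ih => exact (ih (Fin.init ω)).step_succ hγ0 hγ1 hN hH hψ hF hα0 hα _

/-- Multiplying by `(t + 1)(t + 2)` turns the contraction factor into at most `t(t + 1)`, so `t(t +
1) V t` grows additively. The prefactor `t` vanishes at `0`, so no bound on `V 0` is required. -/
lemma recursion_bound {V : ℕ → ℝ} (hV : ∀ t, 0 ≤ V t) {a c : ℝ}
    (h : ∀ t, V (t + 1) ≤ (1 - etaSeq (t + 1)) ^ 2 * V t + (a * etaSeq (t + 1) + c) ^ 2) (t : ℕ) :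
    t * ((t + 1) * V t) ≤ t * (8 * a ^ 2 + 2 * c ^ 2 * t * (t + 1)) := by
  induction t with
  | zero => simp
  | succ t ih =>
    have h1 := h t
    have hη : etaSeq (t + 1) = 2 / ((t : ℝ) + 2) := by
      rw [etaSeq]; push_cast; ring
    rw [hη] at h1
    have ht : (0 : ℝ) ≤ t := Nat.cast_nonneg t
    set x : ℝ := (t : ℝ)
    have hx : x + 2 ≠ 0 := by positivity
    have e1 : (x + 1) * (x + 2) * (1 - 2 / (x + 2)) ^ 2 = x * (x + 1) * (x / (x + 2)) := by
      field_simp; ring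
    have e2 : x / (x + 2) ≤ 1 := by rw [div_le_one (by positivity)]; linarith
    have e3 : (x + 1) * (x + 2) * ((1 - 2 / (x + 2)) ^ 2 * V t) ≤ x * ((x + 1) * V t) := by
      have := mul_le_mul_of_nonneg_left e2
        (mul_nonneg (mul_nonneg ht (by linarith : 0 ≤ x + 1)) (hV t))
      calc _ = ((x + 1) * (x + 2) * (1 - 2 / (x + 2)) ^ 2) * V t := by ring
        _ = x * (x + 1) * V t * (x / (x + 2)) := by rw [e1]; ring
        _ ≤ _ := by linarith
    have e4 : (a * (2 / (x + 2)) + c) ^ 2 ≤ 8 * a ^ 2 / (x + 2) ^ 2 + 2 * c ^ 2 := by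
      have : 8 * a ^ 2 / (x + 2) ^ 2 = 2 * (a * (2 / (x + 2))) ^ 2 := by field_simp; ring
      rw [this]
      nlinarith [sq_nonneg (a * (2 / (x + 2)) - c)]
    have e5 : (x + 1) * (x + 2) * (8 * a ^ 2 / (x + 2) ^ 2) ≤ 8 * a ^ 2 := by
      rw [mul_div_assoc', div_le_iff₀ (by positivity)]
      nlinarith [sq_nonneg a, mul_nonneg (sq_nonneg a) ht]
    have e6 := mul_le_mul_of_nonneg_left h1 (by positivity : 0 ≤ (x + 1) * (x + 2))
    have e7 := mul_le_mul_of_nonneg_left e4 (by positivity : 0 ≤ (x + 1) * (x + 2))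
    have e8 : x * (2 * c ^ 2 * x * (x + 1)) ≤ x * (2 * c ^ 2 * (x + 1) * (x + 2)) := by
      have : 0 ≤ x * (2 * c ^ 2) * (x + 1) := by positivity
      nlinarith
    push_cast
    calc (x + 1) * ((x + 1 + 1) * V (t + 1)) = (x + 1) * (x + 2) * V (t + 1) := by ring
      _ ≤ x * ((x + 1) * V t) + (8 * a ^ 2 + (x + 1) * (x + 2) * (2 * c ^ 2)) := by linarith
      _ ≤ _ := by linarith

/-- The standard deviation in the second half of the run. -/
lemma recursion_bound_le_sq {V : ℕ → ℝ} (hV : ∀ t, 0 ≤ V t) {a c : ℝ} (ha : 0 ≤ a) (hc : 0 ≤ c)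
    (h : ∀ t, V (t + 1) ≤ (1 - etaSeq (t + 1)) ^ 2 * V t + (a * etaSeq (t + 1) + c) ^ 2)
    {t T : ℕ} (ht : 1 ≤ t) (htT : t ≤ T) (hTt : T + 1 ≤ 2 * (t + 1)) :
    V t ≤ (4 * a / √(T + 1) + 2 * c * √(T + 1)) ^ 2 := by
  have h1 := recursion_bound hV h t
  have ht0 : (0 : ℝ) < t := by exact_mod_cast ht
  have h2 := le_of_mul_le_mul_left h1 ht0
  have hT : (t : ℝ) ≤ T := by exact_mod_cast htT
  have hT' : (T : ℝ) + 1 ≤ 2 * (t + 1) := by exact_mod_cast hTt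
  have hy : (0 : ℝ) < √(T + 1) := Real.sqrt_pos.2 (by positivity)
  have hy2 : √((T : ℝ) + 1) ^ 2 = T + 1 := Real.sq_sqrt (by positivity)
  set y := √((T : ℝ) + 1)
  have h3 : 16 * a ^ 2 / (T + 1) + 4 * c ^ 2 * (T + 1) ≤ (4 * a / y + 2 * c * y) ^ 2 := by
    have : (4 * a / y + 2 * c * y) ^ 2 = 16 * a ^ 2 / y ^ 2 + 16 * a * c + 4 * c ^ 2 * y ^ 2 := by
      field_simp; ring
    rw [this, hy2]
    have : 0 ≤ 16 * a * c := by positivity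
    linarith
  refine le_trans ?_ h3
  have h4 : V t ≤ 8 * a ^ 2 / (t + 1) + 2 * c ^ 2 * t := by
    have : 8 * a ^ 2 / (t + 1) + 2 * c ^ 2 * t =
        (8 * a ^ 2 + 2 * c ^ 2 * t * (t + 1)) / ((t : ℝ) + 1) := by field_simp
    rw [this, le_div_iff₀ (by positivity)]
    linarith
  have h5 : 8 * a ^ 2 / ((t : ℝ) + 1) ≤ 16 * a ^ 2 / (T + 1) := by
    rw [div_le_div_iff₀ (by positivity) (by positivity)]
    nlinarith [sq_nonneg a]
  have h6 : 2 * c ^ 2 * t ≤ 4 * c ^ 2 * ((T : ℝ) + 1) := by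
    nlinarith [sq_nonneg c, mul_nonneg (sq_nonneg c) ht0.le]
  linarith

lemma expect_err_le (hγ0 : 0 < γ) (hγ1 : γ < 1) (hN : 1 ≤ N) (hH : (H : ℝ) ≤ N)
    (hψ : PolicyRegular ψ N N) (hF : UtilityRegular F N N N) (hα0 : 0 ≤ α)
    (hα : 2 * N ^ 2 * α ≤ 1) {t T : ℕ} (ht : 1 ≤ t) (htT : t ≤ T) (hTt : T + 1 ≤ 2 * (t + 1)) :
    expect M γ ψ F α H θ₀ (t + 1) (errLam M γ ψ H) ≤
        40 * N ^ 5 / √(T + 1) + 76 * N ^ 7 * α * √(T + 1) ∧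
      expect M γ ψ F α H θ₀ (t + 1) (errDir M γ ψ H) ≤
        40 * N ^ 5 / √(T + 1) + 76 * N ^ 7 * α * √(T + 1) := by
  have hy : (0 : ℝ) < √(T + 1) := Real.sqrt_pos.2 (by positivity)
  have key : ∀ err : State S A d → ℝ, (∀ n (s : State S A d), s.Bounded F N α n →
      ∑ τ : Traj S A H, M.trajProb (softmax ψ s.θ) H τ *
        err (step γ ψ F etaSeq (fun _ => α) (n + 1) s τ) ^ 2 ≤
      (1 - etaSeq (n + 1)) ^ 2 * err s ^ 2 +
        (10 * N ^ 5 * etaSeq (n + 1) + 38 * N ^ 7 * α) ^ 2) →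
      expect M γ ψ F α H θ₀ (t + 1) err ≤
        40 * N ^ 5 / √(T + 1) + 76 * N ^ 7 * α * √(T + 1) := by
    intro err herr
    refine expect_le_of_expect_sq_le (by positivity) ?_
    have h := recursion_bound_le_sq
      (V := fun t => expect M γ ψ F α H θ₀ (t + 1) fun s => err s ^ 2)
      (fun t => expect_nonneg _ fun s => sq_nonneg _) (a := 10 * N ^ 5) (c := 38 * N ^ 7 * α)
      (by positivity) (by positivity) (fun n => ?_) ht htT hTt
    · refine h.trans (le_of_eq ?_)
      ring
    · refine (expect_succ_le_expect (g := fun s => (1 - etaSeq (n + 1)) ^ 2 * err s ^ 2 +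
        (10 * N ^ 5 * etaSeq (n + 1) + 38 * N ^ 7 * α) ^ 2) fun ω _ => herr n _
        (bounded_run hγ0 hγ1 hN hH hψ hF hα0 hα n ω)).trans (le_of_eq ?_)
      rw [expect_add, expect_const_mul, expect_const]
  exact ⟨key _ fun n s hs => hs.sum_errLam_sq_le hγ0 hγ1 hN hH hψ hα0 hα,
    key _ fun n s hs => hs.sum_errDir_sq_le hγ0 hγ1 hN hH hψ hF hα0 hα⟩

end Expect

/-! ### Contraction of the optimality gap. -/

section Gap

variable [Nonempty A] {M : MDP S A} {ψ : S → A → Param d → ℝ} {F : SAVec S A → ℝ}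
  {γ N α ℓ εbar : ℝ} {H : ℕ} {θ₀ θs : Param d} {Θ : Set (Param d)}

lemma l1_occ_sub_occ_le (hγ0 : 0 < γ) (hγ1 : γ < 1) (θ θ' : Param d) :
    l1 (occ M γ ψ θ - occ M γ ψ θ') ≤ 2 * (1 - γ)⁻¹ := by
  refine (l1_sub_le _ _).trans ?_
  have h1 := M.l1_occupancy_le hγ0 hγ1 (isPolicy_softmax ψ θ)
  have h2 := M.l1_occupancy_le hγ0 hγ1 (isPolicy_softmax ψ θ')
  simp only [occ]
  linarith

/-- A parameter near `θ` whose occupancy measure lies on the segment towards the optimum. -/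
lemma LocallyInvertible.exists_near (hinv : LocallyInvertible M γ ψ θs Θ ℓ εbar)
    (hγ0 : 0 < γ) (hγ1 : γ < 1) (hN : 1 ≤ N) (hγN : (1 - γ)⁻¹ ≤ N) (hℓN : ℓ ≤ N)
    (hconc : ConcaveOn ℝ (convexHull ℝ (M.occupancySet γ)) F) (hα : 0 < α)
    (hαN : α / (2 * N ^ 2) ≤ 1) (hε : α / (2 * N ^ 2) ≤ εbar) {θ : Param d} (hθ : θ ∈ Θ) :
    ∃ θ', ‖θ' - θ‖ ≤ α ∧ α / (2 * N ^ 2) * (F (occ M γ ψ θs) - F (occ M γ ψ θ)) ≤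
      F (occ M γ ψ θ') - F (occ M γ ψ θ) := by
  obtain ⟨U, V, hU, -, -, hbij, hlip, hseg⟩ := hinv θ hθ
  have hN0 : 0 < N := by linarith
  have hε0 : 0 < α / (2 * N ^ 2) := by positivity
  -- Two occupancy measures are at distance at most `2N` and the inverse is `N`-Lipschitz, so the
  -- fraction `α / (2 * N ^ 2)` of the segment costs a parameter displacement of at most `α`.
  have h2ε : N * (α / (2 * N ^ 2) * (2 * N)) = α := by field_simp
  set ε := α / (2 * N ^ 2)
  obtain ⟨θ', hθ'U, hθ'⟩ := hbij.surjOn (hseg ε hε0 hε)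
  refine ⟨θ', ?_, ?_⟩
  · have h1 : occ M γ ψ θ' - occ M γ ψ θ = ε • (occ M γ ψ θs - occ M γ ψ θ) := by
      rw [hθ']; module
    have h2 := hlip θ' hθ'U θ hU
    have h3 : ‖occ M γ ψ θs - occ M γ ψ θ‖ ≤ 2 * N :=
      (norm_le_l1 _).trans ((l1_occ_sub_occ_le hγ0 hγ1 _ _).trans (by linarith))
    rw [h1, norm_smul, Real.norm_eq_abs, abs_of_pos hε0] at h2
    calc _ ≤ ℓ * (ε * ‖occ M γ ψ θs - occ M γ ψ θ‖) := h2
      _ ≤ N * (ε * ‖occ M γ ψ θs - occ M γ ψ θ‖) :=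
        mul_le_mul_of_nonneg_right hℓN (by positivity)
      _ ≤ N * (ε * (2 * N)) := by gcongr
      _ = α := h2ε
  · have hmem : ∀ θ, occ M γ ψ θ ∈ convexHull ℝ (M.occupancySet γ) := fun θ =>
      subset_convexHull ℝ _ ⟨_, isPolicy_softmax ψ θ, rfl⟩
    have := hconc.2 (hmem θ) (hmem θs) (by linarith : 0 ≤ 1 - ε) hε0.le (by ring)
    rw [← hθ'] at this
    simp only [smul_eq_mul] at this
    linarith

/-- The linear model with direction `dir` is accurate to the same order at the new iterate and at
the comparison point of `LocallyInvertible.exists_near`. Using it at both points produces the factor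
`2 * α`. -/
lemma State.Bounded.gap_step_le {n : ℕ} {s : State S A d} (hs : s.Bounded F N α n)
    (hinv : LocallyInvertible M γ ψ θs Θ ℓ εbar) (hθ : s.θ ∈ Θ)
    (hγ0 : 0 < γ) (hγ1 : γ < 1) (hN : 1 ≤ N) (hγN : (1 - γ)⁻¹ ≤ N) (hH : (H : ℝ) ≤ N)
    (hℓN : ℓ ≤ N) (hψ : PolicyRegular ψ N N) (hF : UtilityRegular F N N N)
    (hconc : ConcaveOn ℝ (convexHull ℝ (M.occupancySet γ)) F) (hα0 : 0 < α)
    (hα : 2 * N ^ 2 * α ≤ 1) (hε : α / (2 * N ^ 2) ≤ εbar) (τ : Traj S A H) :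
    F (occ M γ ψ θs) - F (occ M γ ψ (step γ ψ F etaSeq (fun _ => α) (n + 1) s τ).θ) ≤
      (1 - α / (2 * N ^ 2)) * (F (occ M γ ψ θs) - F (occ M γ ψ s.θ)) +
      2 * α * (errDir M γ ψ H (step γ ψ F etaSeq (fun _ => α) (n + 1) s τ) +
        4 * N ^ 4 * errLam M γ ψ H s + 42 * N ^ 7 * α + 12 * N ^ 5 * γ ^ H) := by
  have hN2 : 1 ≤ N ^ 2 := one_le_pow₀ hN
  have hαN : α / (2 * N ^ 2) ≤ 1 := by
    rw [div_le_one (by positivity)]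
    nlinarith
  obtain ⟨θ', hθ', hasc⟩ := hinv.exists_near hγ0 hγ1 hN hγN hℓN hconc hα0 hαN hε hθ
  set s' := step γ ψ F etaSeq (fun _ => α) (n + 1) s τ with hs'
  have hγH : 0 < γ ^ H := by positivity
  have hr : ∀ i, |s.r i| ≤ N := by rw [hs.r_eq]; exact hF.grad_le _
  have hlam0 : 0 ≤ errLam M γ ψ H s := norm_nonneg _
  set eL := errLam M γ ψ H s with heL
  set κ := 4 * N ^ 4 * eL + 42 * N ^ 7 * α + 12 * N ^ 5 * γ ^ H with hκ
  have hσ : ∀ i, |gradient F (occ M γ ψ s.θ) i - s.r i| ≤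
      N * (eL + 4 * N ^ 3 * α + N * γ ^ H) := by
    intro i
    rw [hs.r_eq]
    refine (hF.grad_lip _ _ i).trans (mul_le_mul_of_nonneg_left ?_ (by linarith))
    -- The reward comes from an estimate of the occupancy at the previous parameter, whence a
    -- truncation, a drift and an estimation term.
    have e : occ M γ ψ s.θ - s.lam =
        (occ M γ ψ s.θ - M.truncOcc γ (softmax ψ s.θ) H) +
        (M.truncOcc γ (softmax ψ s.θ) H - M.truncOcc γ (softmax ψ s.θprev) H) -
        (s.lam - M.truncOcc γ (softmax ψ s.θprev) H) := by abel
    have h1 : ‖occ M γ ψ s.θ - M.truncOcc γ (softmax ψ s.θ) H‖ ≤ N * γ ^ H := by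
      refine (norm_le_l1 _).trans ((M.l1_occupancy_sub_truncOcc_le hγ0 hγ1
        (isPolicy_softmax ψ s.θ) H).trans ?_)
      rw [mul_comm]
      exact mul_le_mul_of_nonneg_right hγN hγH.le
    have h2 : ‖M.truncOcc γ (softmax ψ s.θ) H - M.truncOcc γ (softmax ψ s.θprev) H‖ ≤
        4 * N ^ 3 * α :=
      (norm_le_l1 _).trans ((M.l1_truncOcc_sub_le hγ0 hγ1 hN hH hψ _ _).trans
        (mul_le_mul_of_nonneg_left hs.dist_le (by positivity)))
    rw [e]
    refine (norm_sub_le _ _).trans ((add_le_add (norm_add_le _ _) le_rfl).trans ?_)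
    simp only [heL, errLam]
    linarith
  have key : ∀ ϑ, ‖ϑ - s.θ‖ ≤ α →
      |F (occ M γ ψ ϑ) - F (occ M γ ψ s.θ) - inner ℝ s'.dir (ϑ - s.θ)| ≤
        α * (errDir M γ ψ H s' + κ) := by
    intro ϑ hϑ
    have h1 := M.abs_utility_sub_sub_inner_meanGrad_le hγ0 hγ1 hN hγN hH hψ hF
      ((mul_le_mul_of_nonneg_left hϑ (by positivity)).trans hα) hr hσ
    have h2 : |inner ℝ (s'.dir - M.meanGrad γ ψ H s.θ s.r) (ϑ - s.θ)| ≤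
        errDir M γ ψ H s' * α :=
      (abs_real_inner_le_norm _ _).trans (mul_le_mul_of_nonneg_left hϑ (norm_nonneg _))
    have h3 : (8 * N ^ 4 * γ ^ H + 4 * N ^ 3 * (N * (eL + 4 * N ^ 3 * α + N * γ ^ H))) *
        ‖ϑ - s.θ‖ + 26 * N ^ 7 * ‖ϑ - s.θ‖ ^ 2 ≤ α * κ := by
      have h4 : N ^ 4 * γ ^ H ≤ N ^ 5 * γ ^ H :=
        mul_le_mul_of_nonneg_right (pow_le_pow_right₀ hN (by norm_num)) hγH.le
      calc _ ≤ (8 * N ^ 4 * γ ^ H + 4 * N ^ 3 * (N * (eL + 4 * N ^ 3 * α + N * γ ^ H))) * α +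
            26 * N ^ 7 * α ^ 2 := by gcongr
        _ ≤ _ := by
            rw [hκ]
            nlinarith
    have e : F (occ M γ ψ ϑ) - F (occ M γ ψ s.θ) - inner ℝ s'.dir (ϑ - s.θ) =
        (F (occ M γ ψ ϑ) - F (occ M γ ψ s.θ) -
          inner ℝ (M.meanGrad γ ψ H s.θ s.r) (ϑ - s.θ)) -
        inner ℝ (s'.dir - M.meanGrad γ ψ H s.θ s.r) (ϑ - s.θ) := by
      rw [inner_sub_left]; ring
    rw [e]
    refine (abs_sub _ _).trans ?_
    linarith
  have k1 := (abs_le.1 (key s'.θ (norm_normStep_sub_le hα0.le _ _))).1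
  have k2 := (abs_le.1 (key θ' hθ')).2
  -- The normalized step attains the maximum of the linear form on the ball of radius `α`, so its
  -- value is at least the value at `θ'`.
  have k3 : inner ℝ s'.dir (s'.θ - s.θ) = α * ‖s'.dir‖ := inner_normStep_sub α s.θ s'.dir
  have k4 : inner ℝ s'.dir (θ' - s.θ) ≤ α * ‖s'.dir‖ := by
    refine (real_inner_le_norm _ _).trans ?_
    rw [mul_comm]
    exact mul_le_mul_of_nonneg_right hθ' (norm_nonneg _)
  rw [k3] at k1
  rw [hκ] at k1 k2
  linarith

/-- `c` is the fixed point of the recursion, and the distance to it contracts. -/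
lemma le_of_linear_recursion {x : ℕ → ℝ} {ε c : ℝ} (hε1 : ε ≤ 1) {m : ℕ} (k : ℕ)
    (h : ∀ n, m ≤ n → n < m + k → x (n + 1) ≤ (1 - ε) * x n + ε * c) (hc : 0 ≤ c) :
    x (m + k) ≤ (1 - ε) ^ k * x m + c := by
  have : x (m + k) ≤ (1 - ε) ^ k * x m + (1 - (1 - ε) ^ k) * c := by
    induction k with
    | zero => simp
    | succ k ih =>
      have h1 := ih fun n hn hn' => h n hn (by omega)
      have h2 := h (m + k) (by omega) (by omega)
      have h3 := mul_le_mul_of_nonneg_left h1 (by linarith : 0 ≤ 1 - ε)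
      rw [← add_assoc, pow_succ]
      linarith
  have h4 : 0 ≤ (1 - ε) ^ k * c := mul_nonneg (pow_nonneg (by linarith) _) hc
  linarith

/-- The convergence estimate for a fixed number of iterations; `N` bounds all constants and the
horizon. -/
theorem gap_le (hinv : LocallyInvertible M γ ψ θs Θ ℓ εbar)
    (hγ0 : 0 < γ) (hγ1 : γ < 1) (hN : 1 ≤ N) (hγN : (1 - γ)⁻¹ ≤ N) (hH : (H : ℝ) ≤ N)
    (hℓN : ℓ ≤ N) (hψ : PolicyRegular ψ N N) (hF : UtilityRegular F N N N)
    (hconc : ConcaveOn ℝ (convexHull ℝ (M.occupancySet γ)) F) (hα0 : 0 < α)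
    (hα : 2 * N ^ 2 * α ≤ 1) (hε : α / (2 * N ^ 2) ≤ εbar) {T : ℕ} (hT : 2 ≤ T)
    (hγH : γ ^ H ≤ 1 / (T + 1))
    (hit : ∀ t < T, ∀ ω : Fin t → Traj S A H,
      0 < runProb M γ ψ F etaSeq (fun _ => α) H θ₀ t ω →
      (run γ ψ F etaSeq (fun _ => α) H θ₀ t ω).θ ∈ Θ) :
    F (occ M γ ψ θs) - expectedUtility M γ ψ F etaSeq (fun _ => α) H θ₀ T ≤
      2 * N ^ 2 * (1 - α / (2 * N ^ 2)) ^ (T - (T / 2 + 1)) +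
        1700 * N ^ 13 * (1 / √(T + 1) + α * √(T + 1)) := by
  have hN0 : 0 < N := by linarith
  have hN2 : 1 ≤ N ^ 2 := one_le_pow₀ hN
  have hε1 : α / (2 * N ^ 2) ≤ 1 := by
    rw [div_le_one (by positivity)]
    nlinarith
  have hε0 : 0 < α / (2 * N ^ 2) := by positivity
  have hαε : α / (2 * N ^ 2) * (4 * N ^ 2) = 2 * α := by field_simp; ring
  set ε := α / (2 * N ^ 2)
  have hy : (0 : ℝ) < √(T + 1) := Real.sqrt_pos.2 (by positivity)
  have hy1 : (1 : ℝ) ≤ √(T + 1) :=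
    Real.one_le_sqrt.2 (by linarith [(Nat.cast_nonneg T : (0 : ℝ) ≤ T)])
  have hy2 : √((T : ℝ) + 1) ^ 2 = T + 1 := Real.sq_sqrt (by positivity)
  have hiy : (1 : ℝ) / (T + 1) ≤ 1 / √(T + 1) :=
    one_div_le_one_div_of_le hy (by nlinarith)
  have herr : ∀ t, 1 ≤ t → t ≤ T → T + 1 ≤ 2 * (t + 1) → _ := fun t h1 h2 h3 =>
    expect_err_le (M := M) (θ₀ := θ₀) (ψ := ψ) (F := F) hγ0 hγ1 hN hH hψ hF hα0.le hα h1 h2 h3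
  set y := √((T : ℝ) + 1)
  set B := 40 * N ^ 5 / y + 76 * N ^ 7 * α * y with hB
  set δ : State S A d → ℝ := fun s => F (occ M γ ψ θs) - F (occ M γ ψ s.θ) with hδ
  -- Since `2 * α = 4 * N ^ 2 * ε`, the error of one step equals `ε * c`; the step size cancels in
  -- the limit `c`.
  set c := 4 * N ^ 2 * (B + 4 * N ^ 4 * B + 42 * N ^ 7 * α + 12 * N ^ 5 * γ ^ H) with hc
  -- The occupancy error is taken one iteration earlier than the direction error, so `n - 1` must
  -- also lie in the second half of the run.
  have hstep : ∀ n, T / 2 + 1 ≤ n → n < T / 2 + 1 + (T - (T / 2 + 1)) →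
      expect M γ ψ F α H θ₀ (n + 1) δ ≤ (1 - ε) * expect M γ ψ F α H θ₀ n δ + ε * c := by
    intro n hn hn'
    obtain ⟨m, rfl⟩ : ∃ m, n = m + 1 := ⟨n - 1, by omega⟩
    -- The direction error depends on the new trajectory and so stays on the left with the new gap;
    -- the occupancy error is already known.
    have h1 : expect M γ ψ F α H θ₀ (m + 1 + 1)
          (fun s => δ s + (-(2 * α)) * errDir M γ ψ H s) ≤
        expect M γ ψ F α H θ₀ (m + 1) (fun s => (1 - ε) * δ s + (2 * α * (4 * N ^ 4) *
          errLam M γ ψ H s + 2 * α * (42 * N ^ 7 * α + 12 * N ^ 5 * γ ^ H))) := by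
      refine expect_succ_le_expect fun ω hω => ?_
      have hs := bounded_run (θ₀ := θ₀) hγ0 hγ1 hN hH hψ hF hα0.le hα m ω
      have hθ := hit (m + 1) (by omega) ω hω
      have hπ := isPolicy_softmax ψ (run γ ψ F etaSeq (fun _ => α) H θ₀ (m + 1) ω).θ
      set s := run γ ψ F etaSeq (fun _ => α) H θ₀ (m + 1) ω
      calc _ ≤ ∑ τ : Traj S A H, M.trajProb (softmax ψ s.θ) H τ * ((1 - ε) * δ s +
            (2 * α * (4 * N ^ 4) * errLam M γ ψ H s +
              2 * α * (42 * N ^ 7 * α + 12 * N ^ 5 * γ ^ H))) := by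
            refine Finset.sum_le_sum fun τ _ =>
              mul_le_mul_of_nonneg_left ?_ (M.trajProb_nonneg hπ H τ)
            have := hs.gap_step_le hinv hθ hγ0 hγ1 hN hγN hH hℓN hψ hF hconc hα0 hα hε τ
            simp only [hδ]
            linarith
        _ = _ := by rw [← Finset.sum_mul, M.sum_trajProb hπ, one_mul]
    rw [expect_add, expect_const_mul, expect_add, expect_const_mul, expect_add,
      expect_const_mul, expect_const] at h1
    have h2 := (herr (m + 1) (by omega) (by omega) (by omega)).2
    have h3 := (herr m (by omega) (by omega) (by omega)).1
    have h4 := mul_le_mul_of_nonneg_left h2 (by linarith : 0 ≤ 2 * α)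
    have h5 := mul_le_mul_of_nonneg_left h3 (by positivity : 0 ≤ 2 * α * (4 * N ^ 4))
    have h6 : ε * c = 2 * α * (B + 4 * N ^ 4 * B + 42 * N ^ 7 * α + 12 * N ^ 5 * γ ^ H) := by
      rw [hc, ← mul_assoc, hαε]
    rw [h6]
    linarith
  have hB0 : 0 ≤ B := by positivity
  have hc0 : 0 ≤ c := by positivity
  have hfin := le_of_linear_recursion (x := fun n => expect M γ ψ F α H θ₀ n δ) hε1
    (T - (T / 2 + 1)) hstep hc0
  have hTe : T / 2 + 1 + (T - (T / 2 + 1)) = T := by omega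
  rw [hTe] at hfin
  have hδle : expect M γ ψ F α H θ₀ (T / 2 + 1) δ ≤ 2 * N ^ 2 := by
    rw [← expect_const (M := M) (γ := γ) (ψ := ψ) (F := F) (α := α) (H := H) (θ₀ := θ₀)
      (T / 2 + 1) (2 * N ^ 2)]
    refine expect_mono _ fun s => ?_
    refine (le_abs_self _).trans ((hF.abs_sub_le _ _).trans ?_)
    have := l1_occ_sub_occ_le (M := M) (ψ := ψ) hγ0 hγ1 θs s.θ
    nlinarith
  have hEU : expect M γ ψ F α H θ₀ T δ =
      F (occ M γ ψ θs) - expectedUtility M γ ψ F etaSeq (fun _ => α) H θ₀ T := by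
    have h1 : expect M γ ψ F α H θ₀ T (fun s => F (occ M γ ψ θs) + (-1) * F (occ M γ ψ s.θ)) =
        F (occ M γ ψ θs) - expectedUtility M γ ψ F etaSeq (fun _ => α) H θ₀ T := by
      rw [expect_add, expect_const_mul, expect_const]
      simp only [expect, expectedUtility]
      ring
    rw [← h1]
    congr 1
    funext s
    simp only [hδ]
    ring
  have hcle : c ≤ 1700 * N ^ 13 * (1 / y + α * y) := by
    have hγH' : γ ^ H ≤ 1 / y := hγH.trans hiy
    have hαy : α ≤ α * y := le_mul_of_one_le_right hα0.le hy1
    have hz : 0 < 1 / y := by positivity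
    have hB' : B = 40 * N ^ 5 * (1 / y) + 76 * N ^ 7 * (α * y) := by rw [hB]; ring
    have hpow : ∀ i ≤ 13, N ^ i ≤ N ^ 13 := fun i hi => pow_le_pow_right₀ hN hi
    set z := 1 / y
    set v := α * y
    have hv : 0 < v := by positivity
    calc c ≤ 4 * N ^ 2 * (B + 4 * N ^ 4 * B + 42 * N ^ 7 * v + 12 * N ^ 5 * z) := by
          rw [hc]; gcongr
      _ = 160 * (N ^ 7 * z) + 304 * (N ^ 9 * v) + 640 * (N ^ 11 * z) + 1216 * (N ^ 13 * v) +
          168 * (N ^ 9 * v) + 48 * (N ^ 7 * z) := by rw [hB']; ring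
      _ ≤ 160 * (N ^ 13 * z) + 304 * (N ^ 13 * v) + 640 * (N ^ 13 * z) + 1216 * (N ^ 13 * v) +
          168 * (N ^ 13 * v) + 48 * (N ^ 13 * z) := by
          gcongr 160 * (?_ * z) + 304 * (?_ * v) + 640 * (?_ * z) + 1216 * _ +
            168 * (?_ * v) + 48 * (?_ * z) <;> exact hpow _ (by norm_num)
      _ ≤ _ := by
          have h1 : 0 < N ^ 13 * z := by positivity
          have h2 : 0 < N ^ 13 * v := by positivity
          linarith
  have hpw : 0 ≤ (1 - ε) ^ (T - (T / 2 + 1)) := pow_nonneg (by linarith) _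
  have := mul_le_mul_of_nonneg_left hδle hpw
  rw [hEU] at hfin
  linarith

end Gap

/-! ### Asymptotics in the number of iterations. -/

open Filter Topology

lemma eventually_mul_polylog_le {k : ℕ} (hk : k ≠ 0) {s b : ℝ} (hs : 0 < s) (c : ℝ) (hb : 0 < b) :
    ∀ᶠ x : ℝ in atTop, c * (1 + Real.log x) ^ k * x ^ (-s) ≤ b := by
  have hk' : (0 : ℝ) < k := by exact_mod_cast Nat.pos_of_ne_zero hk
  have hr : 0 < s / k := div_pos hs hk'
  have h1 : (fun x : ℝ => 1 + Real.log x) =o[atTop] fun x : ℝ => x ^ (s / k) :=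
    ((Asymptotics.isLittleO_const_left.2 (Or.inr (tendsto_norm_atTop_atTop.comp
      (tendsto_rpow_atTop hr)))).add (isLittleO_log_rpow_atTop hr))
  have h2 := (h1.pow (Nat.pos_of_ne_zero hk)).const_mul_left c
  filter_upwards [h2.def hb, eventually_gt_atTop 0] with x hx hx0
  have h3 : (x ^ (s / k)) ^ k = x ^ s := by
    rw [← Real.rpow_natCast, ← Real.rpow_mul hx0.le, div_mul_cancel₀ _ hk'.ne']
  have hxs : 0 < x ^ s := Real.rpow_pos_of_pos hx0 s
  rw [h3, Real.norm_eq_abs, Real.norm_eq_abs, abs_of_pos hxs] at hx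
  rw [Real.rpow_neg hx0.le, ← div_eq_mul_inv, div_le_iff₀ hxs]
  exact (le_abs_self _).trans hx

lemma eventually_exp_neg_rpow_le {s r b : ℝ} (hs : 0 < s) (hb : 0 < b) :
    ∀ᶠ x : ℝ in atTop, Real.exp (-x ^ s) ≤ b * x ^ (-r) := by
  have h1 := (tendsto_rpow_mul_exp_neg_mul_atTop_nhds_zero (r / s) 1 one_pos).comp
    (tendsto_rpow_atTop hs)
  filter_upwards [h1.eventually_le_const hb, eventually_gt_atTop 0] with x hx hx0
  simp only [Function.comp] at hx
  rw [← Real.rpow_mul hx0.le, mul_div_cancel₀ _ hs.ne', neg_one_mul] at hx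
  rw [Real.rpow_neg hx0.le, ← div_eq_mul_inv, le_div_iff₀ (Real.rpow_pos_of_pos hx0 r), mul_comm]
  exact hx

lemma eventually_convergence_bound_le {K α₀ a : ℝ} (hK : 1 ≤ K) (hα₀ : 0 < α₀) (ha0 : 0 < a)
    (ha1 : a < 1) :
    ∀ᶠ x : ℝ in atTop, 2 * (K * (1 + Real.log x)) ^ 2 * (α₀ / x ^ a) ≤ 1 ∧
      2 * (K * (1 + Real.log x)) ^ 2 *
          Real.exp (-(α₀ / x ^ a / (2 * (K * (1 + Real.log x)) ^ 2) * (x / 4))) +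
        1700 * (K * (1 + Real.log x)) ^ 13 * (1 / √x + α₀ / x ^ a * √x) ≤
      x ^ (-(3 / 2 * a - 1)) := by
  have hK0 : 0 < K := by linarith
  -- The margins are `1 / 2 - q = 3 (1 - a) / 2` and `a - 1 / 2 - q = (1 - a) / 2`, both positive.
  -- Each of the three summands is brought below a third of `x ^ (-q)`.
  set q := 3 / 2 * a - 1 with hq
  have e1 := eventually_mul_polylog_le (k := 2) two_ne_zero ha0 (2 * K ^ 2 * α₀) one_pos
  have e2 := eventually_mul_polylog_le (k := 13) (by norm_num) (s := 1 / 2 - q) (by linarith)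
    (1700 * K ^ 13) (by norm_num : (0 : ℝ) < 1 / 3)
  have e3 := eventually_mul_polylog_le (k := 13) (by norm_num) (s := a - 1 / 2 - q) (by linarith)
    (1700 * K ^ 13 * α₀) (by norm_num : (0 : ℝ) < 1 / 3)
  have e4 := eventually_mul_polylog_le (k := 2) two_ne_zero (s := (1 - a) / 2) (by linarith)
    (8 * K ^ 2) hα₀
  have e5 := eventually_mul_polylog_le (k := 2) two_ne_zero (s := 1) one_pos
    (2 * K ^ 2) (by norm_num : (0 : ℝ) < 1 / 3)
  have e6 := eventually_exp_neg_rpow_le (s := (1 - a) / 2) (r := 1 + q) (by linarith) one_pos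
  filter_upwards [e1, e2, e3, e4, e5, e6, eventually_ge_atTop 1] with x h1 h2 h3 h4 h5 h6 hx1
  have hx : 0 < x := by linarith
  have hL : 0 < 1 + Real.log x := by linarith [Real.log_nonneg hx1]
  set L := 1 + Real.log x
  have hxq : 0 < x ^ (-q) := Real.rpow_pos_of_pos hx _
  have hαx : α₀ / x ^ a = α₀ * x ^ (-a) := by rw [Real.rpow_neg hx.le, div_eq_mul_inv]
  have hs1 : 1 / √x = x ^ (-(1 / 2) : ℝ) := by
    rw [Real.sqrt_eq_rpow, Real.rpow_neg hx.le, one_div]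
  have hs2 : √x = x ^ (1 / 2 : ℝ) := Real.sqrt_eq_rpow x
  rw [hαx, hs1, hs2]
  constructor
  · refine le_trans (le_of_eq ?_) h1
    ring
  have k2 : 1700 * (K * L) ^ 13 * x ^ (-(1 / 2) : ℝ) ≤ 1 / 3 * x ^ (-q) := by
    have e : x ^ (-(1 / 2) : ℝ) = x ^ (-(1 / 2 - q)) * x ^ (-q) := by
      rw [← Real.rpow_add hx]; congr 1; ring
    rw [e]
    refine le_trans (le_of_eq ?_) (mul_le_mul_of_nonneg_right h2 hxq.le)
    ring
  have k3 : 1700 * (K * L) ^ 13 * (α₀ * x ^ (-a) * x ^ (1 / 2 : ℝ)) ≤ 1 / 3 * x ^ (-q) := by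
    have e : x ^ (-a) * x ^ (1 / 2 : ℝ) = x ^ (-(a - 1 / 2 - q)) * x ^ (-q) := by
      rw [← Real.rpow_add hx, ← Real.rpow_add hx]; congr 1; ring
    rw [mul_assoc α₀, e]
    refine le_trans (le_of_eq ?_) (mul_le_mul_of_nonneg_right h3 hxq.le)
    ring
  -- The total contraction is of order `x ^ (1 - a)` over a squared logarithm; half of the exponent
  -- pays for the logarithm.
  have k4 : x ^ ((1 - a) / 2) ≤ α₀ * x ^ (-a) / (2 * (K * L) ^ 2) * (x / 4) := by
    have e : x ^ (-a) * x = x ^ ((1 - a) / 2) * x ^ ((1 - a) / 2) := by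
      rw [← Real.rpow_add_one hx.ne', ← Real.rpow_add hx]; congr 1; ring
    have hy : 0 < x ^ ((1 - a) / 2) := Real.rpow_pos_of_pos hx _
    rw [Real.rpow_neg hx.le, ← div_eq_mul_inv, div_le_iff₀ hy] at h4
    have e' : α₀ * x ^ (-a) / (2 * (K * L) ^ 2) * (x / 4) =
        α₀ * (x ^ (-a) * x) / (8 * K ^ 2 * L ^ 2) := by field_simp; ring
    rw [e', e, le_div_iff₀ (by positivity)]
    nlinarith
  have k5 : 2 * (K * L) ^ 2 * Real.exp (-(α₀ * x ^ (-a) / (2 * (K * L) ^ 2) * (x / 4))) ≤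
      1 / 3 * x ^ (-q) := by
    have e : x ^ (-(1 + q)) = x ^ (-1 : ℝ) * x ^ (-q) := by
      rw [← Real.rpow_add hx]; congr 1; ring
    calc _ ≤ 2 * (K * L) ^ 2 * Real.exp (-x ^ ((1 - a) / 2)) := by gcongr
      _ ≤ 2 * (K * L) ^ 2 * (1 * x ^ (-(1 + q))) := by gcongr
      _ = (2 * K ^ 2 * L ^ 2 * x ^ (-1 : ℝ)) * x ^ (-q) := by rw [e]; ring
      _ ≤ _ := mul_le_mul_of_nonneg_right h5 hxq.le
  rw [mul_add (1700 * (K * L) ^ 13)]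
  linarith

lemma eventually_natCast_add_one {p : ℝ → Prop} (h : ∀ᶠ x in atTop, p x) :
    ∀ᶠ T : ℕ in atTop, p ((T : ℝ) + 1) :=
  (tendsto_atTop_add_const_right _ 1 tendsto_natCast_atTop_atTop).eventually h

lemma horizon_le {γ K : ℝ} (hγ1 : γ < 1) (hK : (1 - γ)⁻¹ + 1 ≤ K) (T : ℕ) :
    (horizon γ T : ℝ) ≤ K * (1 + Real.log (T + 1)) := by
  have h0 : 0 < (1 - γ)⁻¹ := inv_pos.2 (by linarith)
  have hl : 0 ≤ Real.log ((T : ℝ) + 1) :=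
    Real.log_nonneg (by linarith [(Nat.cast_nonneg T : (0 : ℝ) ≤ T)])
  have h1 := (Nat.ceil_lt_add_one (div_nonneg hl (by linarith : 0 ≤ 1 - γ))).le
  rw [div_eq_mul_inv] at h1
  refine h1.trans ?_
  nlinarith

lemma pow_horizon_le {γ : ℝ} (hγ0 : 0 < γ) (hγ1 : γ < 1) (T : ℕ) :
    γ ^ horizon γ T ≤ 1 / ((T : ℝ) + 1) := by
  have h1 : γ ≤ Real.exp (-(1 - γ)) := by
    have := Real.add_one_le_exp (-(1 - γ))
    linarith
  have h2 : Real.log ((T : ℝ) + 1) ≤ horizon γ T * (1 - γ) := by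
    rw [← div_le_iff₀ (by linarith)]
    exact Nat.le_ceil _
  calc γ ^ horizon γ T ≤ Real.exp (-(1 - γ)) ^ horizon γ T := pow_le_pow_left₀ hγ0.le h1 _
    _ = Real.exp (-(horizon γ T * (1 - γ))) := by rw [← Real.exp_nat_mul]; congr 1; ring
    _ ≤ Real.exp (-Real.log (T + 1)) := Real.exp_le_exp.2 (by linarith)
    _ = 1 / ((T : ℝ) + 1) := by
      rw [Real.exp_neg, Real.exp_log (by positivity), one_div]

lemma rate_pos {α₀ γ : ℝ} (hα₀ : 0 < α₀) (hγ1 : γ < 1) (a : ℝ) (T : ℕ) : 0 < rate α₀ γ a T := by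
  have : 0 < 1 - γ := by linarith
  rw [rate]
  positivity

lemma rate_eq (α₀ γ a : ℝ) (T : ℕ) :
    rate α₀ γ a T = α₀ ^ 2 / (1 - γ) ^ 3 * ((T : ℝ) + 1) ^ (-(2 * a - 3 / 2)) := by
  rw [rate, Real.rpow_neg (by positivity), ← div_div, div_eq_mul_inv _ (_ ^ (2 * a - 3 / 2))]

/-- The exponents differ by `(1 - a) / 2`, and this power of `T + 1` eventually outweighs the
constant `α₀ ^ 2 / (1 - γ) ^ 3`, however small it is. -/
lemma eventually_rpow_neg_le_rate {α₀ γ a : ℝ} (hα₀ : 0 < α₀) (hγ1 : γ < 1) (ha1 : a < 1) :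
    ∀ᶠ T : ℕ in atTop, ((T : ℝ) + 1) ^ (-(3 / 2 * a - 1)) ≤ rate α₀ γ a T := by
  have h1 : 0 < 1 - γ := by linarith
  have hs : 0 < (1 - a) / 2 := by linarith
  have h := eventually_natCast_add_one ((tendsto_rpow_neg_atTop hs).eventually_le_const
    (by positivity : 0 < α₀ ^ 2 / (1 - γ) ^ 3))
  filter_upwards [h] with T hT
  have hx : (0 : ℝ) < (T : ℝ) + 1 := by positivity
  rw [rate_eq]
  refine le_trans (le_of_eq ?_)
    (mul_le_mul_of_nonneg_right hT (Real.rpow_pos_of_pos hx _).le)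
  rw [← Real.rpow_add hx]
  congr 1
  ring

/-- The sampling cost is almost linear in the number of iterations. -/
lemma eventually_cost_le {γ u : ℝ} (hγ1 : γ < 1) (hu : 1 < u) :
    ∀ᶠ X : ℝ in atTop, (⌈X⌉₊ : ℝ) * (horizon γ ⌈X⌉₊ : ℝ) ≤ X ^ u := by
  set K := (1 - γ)⁻¹ + 1
  have hK : 0 < K := by
    have : 0 < (1 - γ)⁻¹ := inv_pos.2 (by linarith)
    positivity
  filter_upwards [eventually_mul_polylog_le (k := 1) one_ne_zero (s := u - 1) (by linarith)
    (4 * K) one_pos, eventually_ge_atTop 2] with X h hX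
  have hX0 : 0 < X := by linarith
  have h1 := (Nat.ceil_lt_add_one hX0.le).le
  have h2 := horizon_le hγ1 le_rfl ⌈X⌉₊
  -- For `2 ≤ X` one has `⌈X⌉₊ + 1 ≤ X + 2 ≤ X ^ 2`.
  have h3 : Real.log (⌈X⌉₊ + 1) ≤ 2 * Real.log X := by
    rw [← Real.log_rpow hX0, Real.rpow_two]
    exact Real.log_le_log (by positivity) (by nlinarith)
  have hl : 0 ≤ Real.log X := Real.log_nonneg (by linarith)
  have h4 : (horizon γ ⌈X⌉₊ : ℝ) ≤ 2 * (K * (1 + Real.log X)) := by nlinarith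
  rw [Real.rpow_neg hX0.le, ← div_eq_mul_inv, div_le_one (Real.rpow_pos_of_pos hX0 _), pow_one] at h
  calc _ ≤ (2 * X) * (2 * (K * (1 + Real.log X))) :=
        mul_le_mul (by linarith) h4 (Nat.cast_nonneg _) (by linarith)
    _ = X * (4 * K * (1 + Real.log X)) := by ring
    _ ≤ X * X ^ (u - 1) := mul_le_mul_of_nonneg_left h hX0.le
    _ = X ^ u := by
      rw [mul_comm, ← Real.rpow_add_one hX0.ne']; congr 1; ring

/-! ### Bounds uniform in the decision process, the parametrization and the utility. -/

lemma PolicyRegular.mono {ψ : S → A → Param d → ℝ} {l L N : ℝ} (h : PolicyRegular ψ l L)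
    (hl : l ≤ N) (hL : L ≤ N) : PolicyRegular ψ N N :=
  ⟨h.contDiff, fun s a θ => (h.grad_le s a θ).trans hl, fun s a θ => (h.hess_le s a θ).trans hL⟩

lemma UtilityRegular.mono {F : SAVec S A → ℝ} {l L Linf N : ℝ} (h : UtilityRegular F l L Linf)
    (hl : l ≤ N) (hL : L ≤ N) (hLinf : Linf ≤ N) : UtilityRegular F N N N :=
  ⟨h.differentiable, fun μ i => (h.grad_le μ i).trans hl,
    fun μ ν i => (h.grad_lip μ ν i).trans (mul_le_mul_of_nonneg_right hL (norm_nonneg _)),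
    fun μ ν i => (h.grad_lip_one μ ν i).trans (mul_le_mul_of_nonneg_right hLinf
      (Finset.sum_nonneg fun _ _ => abs_nonneg _))⟩

lemma optGap_le_const [Nonempty A] {M : MDP S A} {γ : ℝ} {ψ : S → A → Param d → ℝ}
    {F : SAVec S A → ℝ} {l L Linf : ℝ} (hl : 0 < l) (hγ0 : 0 < γ) (hγ1 : γ < 1)
    (hF : UtilityRegular F l L Linf) (θ₀ θs : Param d) (α₀ a : ℝ) (T : ℕ) :
    optGap M γ ψ F θ₀ θs α₀ a T ≤ l * (2 * (1 - γ)⁻¹) := by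
  have h : F (occ M γ ψ θs) - l * (2 * (1 - γ)⁻¹) ≤
      expectedUtility M γ ψ F etaSeq (alphaSeq α₀ a T) (horizon γ T) θ₀ T := by
    have h1 := expect_const (M := M) (γ := γ) (ψ := ψ) (F := F) (α := α₀ / ((T : ℝ) + 1) ^ a)
      (H := horizon γ T) (θ₀ := θ₀) T (F (occ M γ ψ θs) - l * (2 * (1 - γ)⁻¹))
    rw [← h1]
    refine expect_mono (M := M) (γ := γ) (ψ := ψ) (F := F) (H := horizon γ T) (θ₀ := θ₀)
      (g := fun s => F (occ M γ ψ s.θ)) T fun s => ?_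
    have h2 := (le_abs_self _).trans (hF.abs_sub_le (occ M γ ψ θs) (occ M γ ψ s.θ))
    have h3 := mul_le_mul_of_nonneg_left
      (l1_occ_sub_occ_le (M := M) (ψ := ψ) hγ0 hγ1 θs s.θ) hl.le
    linarith
  rw [optGap]
  linarith

/-- The optimality gap is eventually below a power of the number of iterations, uniformly in the
Markov decision process, the parametrization and the utility. -/
theorem exists_forall_optGap_le {lψ Lψ lF LF LFinf ℓ a γ α₀ : ℝ} (hlψ : 0 < lψ) (hLψ : 0 < Lψ)
    (hlF : 0 < lF) (hLF : 0 < LF) (hLFinf : 0 < LFinf) (hℓ : 0 < ℓ) (ha0 : 0 < a) (ha1 : a < 1)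
    (hγ0 : 0 < γ) (hγ1 : γ < 1) (hα₀ : 0 < α₀) :
    ∃ T₁ : ℕ, ∀ (S A : Type*) [Fintype S] [Fintype A] [DecidableEq S] [DecidableEq A] [Nonempty A]
      (M : MDP S A) (d : ℕ) (ψ : S → A → Param d → ℝ) (F : SAVec S A → ℝ)
      (θ₀ θs : Param d) (Θ : Set (Param d)) (εbar : ℝ) (T : ℕ), T₁ ≤ T →
      PolicyRegular ψ lψ Lψ → UtilityRegular F lF LF LFinf →
      ConcaveOn ℝ (convexHull ℝ (M.occupancySet γ)) F →
      IteratesIn M γ ψ F θ₀ α₀ a T Θ →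
      LocallyInvertible M γ ψ θs Θ ℓ εbar →
      α₀ * (1 - γ) / (2 * ℓ * ((T : ℝ) + 1) ^ a) ≤ εbar →
      optGap M γ ψ F θ₀ θs α₀ a T ≤ ((T : ℝ) + 1) ^ (-(3 / 2 * a - 1)) := by
  have hγ2 : 0 < 1 - γ := by linarith
  have hγi : 0 < (1 - γ)⁻¹ := inv_pos.2 hγ2
  -- The last summand makes `K * (1 + log (T + 1))` dominate the rounded-up horizon, so this product
  -- can serve as `N`.
  set K := lψ + Lψ + lF + LF + LFinf + ℓ + ((1 - γ)⁻¹ + 1)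
  have hK1 : 1 ≤ K := by linarith
  have hKγ : (1 - γ)⁻¹ + 1 ≤ K := by linarith
  obtain ⟨hKlψ, hKLψ, hKlF, hKLF, hKLFinf, hKℓ⟩ :
      lψ ≤ K ∧ Lψ ≤ K ∧ lF ≤ K ∧ LF ≤ K ∧ LFinf ≤ K ∧ ℓ ≤ K := by
    refine ⟨?_, ?_, ?_, ?_, ?_, ?_⟩ <;> linarith
  clear_value K
  -- `5 ≤ T` guarantees that at least `(T + 1) / 4` contracting iterations remain after `T / 2 + 1`.
  obtain ⟨T₁, hT₁⟩ := eventually_atTop.1 ((eventually_natCast_add_one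
    (eventually_convergence_bound_le hK1 hα₀ ha0 ha1)).and (eventually_ge_atTop 5))
  refine ⟨T₁, fun S A _ _ _ _ _ M d ψ F θ₀ θs Θ εbar T hT hψ hF hconc hit hinv hε => ?_⟩
  have hT5 := (hT₁ T hT).2
  have hT5' : (5 : ℝ) ≤ T := by exact_mod_cast hT5
  have hx : (0 : ℝ) < (T : ℝ) + 1 := by positivity
  have hxa : 0 < ((T : ℝ) + 1) ^ a := Real.rpow_pos_of_pos hx a
  have hHN := horizon_le hγ1 hKγ T
  have hKN : K ≤ K * (1 + Real.log (T + 1)) :=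
    le_mul_of_one_le_right (by linarith) (by linarith [Real.log_nonneg (by linarith :
      (1 : ℝ) ≤ (T : ℝ) + 1)])
  have hα := (hT₁ T hT).1.1
  set N := K * (1 + Real.log (T + 1))
  have hN1 : 1 ≤ N := hK1.trans hKN
  have hα0 : 0 < α₀ / ((T : ℝ) + 1) ^ a := by positivity
  have hεN : α₀ / ((T : ℝ) + 1) ^ a / (2 * N ^ 2) ≤ εbar := by
    refine le_trans ?_ hε
    rw [div_div, div_le_div_iff₀ (by positivity) (by positivity)]
    have h1 : 1 ≤ N * (1 - γ) := by
      have := mul_le_mul_of_nonneg_right (by linarith : (1 - γ)⁻¹ ≤ N) hγ2.le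
      rwa [inv_mul_cancel₀ hγ2.ne'] at this
    have h2 : ℓ ≤ N ^ 2 * (1 - γ) := by
      calc ℓ ≤ N * 1 := by linarith
        _ ≤ N * (N * (1 - γ)) := mul_le_mul_of_nonneg_left h1 (by linarith)
        _ = _ := by ring
    have h3 : 0 ≤ α₀ * (2 * ((T : ℝ) + 1) ^ a) := by positivity
    have := mul_le_mul_of_nonneg_left h2 h3
    linarith
  have hgap := gap_le (θ₀ := θ₀) (T := T) hinv hγ0 hγ1 hN1 (by linarith) hHN (by linarith)
    (hψ.mono (by linarith) (by linarith))
    (hF.mono (by linarith) (by linarith) (by linarith)) hconc hα0 hα hεN (by omega)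
    (pow_horizon_le hγ0 hγ1 T) hit
  refine (hgap.trans (add_le_add ?_ le_rfl)).trans (hT₁ T hT).1.2
  refine mul_le_mul_of_nonneg_left ?_ (by positivity)
  have hε0 : 0 < α₀ / ((T : ℝ) + 1) ^ a / (2 * N ^ 2) := by positivity
  have hε1 : α₀ / ((T : ℝ) + 1) ^ a / (2 * N ^ 2) ≤ 1 := by
    have h1 : 1 ≤ 2 * N ^ 2 := by linarith [one_le_pow₀ hN1 (n := 2)]
    rw [div_le_one (by positivity)]
    exact ((le_mul_of_one_le_left hα0.le h1).trans hα).trans h1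
  set ε := α₀ / ((T : ℝ) + 1) ^ a / (2 * N ^ 2)
  have hm : ((T : ℝ) + 1) / 4 ≤ ((T - (T / 2 + 1) : ℕ) : ℝ) := by
    have : T + 1 ≤ 4 * (T - (T / 2 + 1)) := by omega
    have : (T : ℝ) + 1 ≤ 4 * ((T - (T / 2 + 1) : ℕ) : ℝ) := by exact_mod_cast this
    linarith
  calc (1 - ε) ^ (T - (T / 2 + 1)) ≤ Real.exp (-ε) ^ (T - (T / 2 + 1)) :=
        pow_le_pow_left₀ (by linarith) (by linarith [Real.add_one_le_exp (-ε)]) _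
    _ = Real.exp (-(ε * ((T - (T / 2 + 1) : ℕ) : ℝ))) := by
        rw [← Real.exp_nat_mul]; congr 1; ring
    _ ≤ Real.exp (-(ε * (((T : ℝ) + 1) / 4))) :=
        Real.exp_le_exp.2 (neg_le_neg (mul_le_mul_of_nonneg_left hm hε0.le))

end NVRPG

end

open NVRPG in
theorem mainTheorem2 (lψ Lψ lF LF LFinf ℓ : ℝ) (hlψ : 0 < lψ) (hLψ : 0 < Lψ) (hlF : 0 < lF)
    (hLF : 0 < LF) (hLFinf : 0 < LFinf) (hℓ : 0 < ℓ) :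
    ∃ C : ℝ, 0 < C ∧
      ∀ a γ α₀ : ℝ, 0 < a → a < 1 → 0 < γ → γ < 1 → 0 < α₀ →
      ∃ (K : ℝ) (T₀ : ℕ) (ε₀ : ℝ) (Tε : ℝ → ℕ), 0 < K ∧ 0 < ε₀ ∧
        (3 / 4 < a → ∀ ε : ℝ, 0 < ε → ε ≤ ε₀ →
          (Tε ε : ℝ) * (horizon γ (Tε ε) : ℝ) ≤ C * ε ^ (-2 / (4 * a - 3))) ∧
        ∀ (S A : Type*) [Fintype S] [Fintype A] [DecidableEq S] [DecidableEq A] [Nonempty A]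
          (M : MDP S A) (d : ℕ) (ψ : S → A → Param d → ℝ) (F : SAVec S A → ℝ)
          (θ₀ θs : Param d) (Θ : Set (Param d)) (εbar : ℝ) (T : ℕ),
          1 ≤ T →
          PolicyRegular ψ lψ Lψ →
          UtilityRegular F lF LF LFinf →
          ConcaveOn ℝ (convexHull ℝ (M.occupancySet γ)) F →
          (∀ θ, F (occ M γ ψ θ) ≤ F (occ M γ ψ θs)) →
          IteratesIn M γ ψ F θ₀ α₀ a T Θ →
          LocallyInvertible M γ ψ θs Θ ℓ εbar →
          α₀ * (1 - γ) / (2 * ℓ * ((T : ℝ) + 1) ^ a) ≤ εbar →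
          optGap M γ ψ F θ₀ θs α₀ a T ≤ K * rate α₀ γ a T ∧
          (T₀ ≤ T → optGap M γ ψ F θ₀ θs α₀ a T ≤ C * rate α₀ γ a T) ∧
          (3 / 4 < a → α₀ = (1 - γ) ^ (3 / 2 : ℝ) →
            ∀ ε : ℝ, 0 < ε → ε ≤ ε₀ → Tε ε ≤ T → optGap M γ ψ F θ₀ θs α₀ a T ≤ ε) := by
  refine ⟨1, one_pos, fun a γ α₀ ha0 ha1 hγ0 hγ1 hα₀ => ?_⟩
  obtain ⟨T₁, hT₁⟩ := exists_forall_optGap_le hlψ hLψ hlF hLF hLFinf hℓ ha0 ha1 hγ0 hγ1 hα₀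
  obtain ⟨T₂, hT₂⟩ := Filter.eventually_atTop.1 (eventually_rpow_neg_le_rate hα₀ hγ1 ha1)
  set D := lF * (2 * (1 - γ)⁻¹) with hD
  have hD0 : 0 < D := mul_pos hlF (mul_pos two_pos (inv_pos.2 (by linarith)))
  set T₀ := max T₁ T₂ with hT₀
  have hrate : ∀ T, 0 < rate α₀ γ a T := rate_pos hα₀ hγ1 a
  -- With `X = ε ^ (-1 / q)` and `q = 3 / 2 * a - 1`, the power `X ^ (q / (2 * a - 3 / 2))` is
  -- exactly the claimed cost. Its exponent exceeds `1` because `a < 1`, which leaves room for the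
  -- logarithmic horizon.
  obtain ⟨X₀, hX₀, hcost⟩ : ∃ X₀ : ℝ, 1 ≤ X₀ ∧ (3 / 4 < a → ∀ X, X₀ ≤ X →
      (⌈X⌉₊ : ℝ) * (horizon γ ⌈X⌉₊ : ℝ) ≤ X ^ ((3 / 2 * a - 1) / (2 * a - 3 / 2)) ∧
      (T₁ : ℝ) ≤ X) := by
    by_cases h : 3 / 4 < a
    · have hu : 1 < (3 / 2 * a - 1) / (2 * a - 3 / 2) := by
        rw [one_lt_div (by linarith)]
        linarith
      obtain ⟨X₀, hX₀⟩ := Filter.eventually_atTop.1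
        ((eventually_cost_le hγ1 hu).and (Filter.eventually_ge_atTop (T₁ : ℝ)))
      exact ⟨max X₀ 1, le_max_right _ _, fun _ X hX => hX₀ X ((le_max_left _ _).trans hX)⟩
    · exact ⟨1, le_rfl, fun h' => absurd h' h⟩
  have hX : ∀ ε : ℝ, 0 < ε → 3 / 4 < a → ε ≤ X₀ ^ (-(3 / 2 * a - 1)) →
      X₀ ≤ ε ^ (-(3 / 2 * a - 1)⁻¹) := by
    intro ε hε ha hεX
    have hq : 0 < 3 / 2 * a - 1 := by linarith
    have h0 : 0 < X₀ := by linarith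
    have h := Real.rpow_le_rpow_of_nonpos hε hεX
      (neg_nonpos.2 (inv_pos.2 hq).le)
    rwa [← Real.rpow_mul h0.le, neg_mul_neg, mul_inv_cancel₀ hq.ne', Real.rpow_one] at h
  -- The sum makes the trivial bound `D` suffice for each of the finitely many `T < T₀`. The
  -- iteration number inverts `T ^ (-q) ≤ ε`, and the threshold on `ε` ensures that it is at least
  -- `X₀`.
  refine ⟨1 + ∑ T ∈ Finset.range T₀, D / rate α₀ γ a T, T₀, X₀ ^ (-(3 / 2 * a - 1)),
    fun ε => ⌈ε ^ (-(3 / 2 * a - 1)⁻¹)⌉₊, ?_, Real.rpow_pos_of_pos (by linarith) _, ?_, ?_⟩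
  · have : 0 ≤ ∑ T ∈ Finset.range T₀, D / rate α₀ γ a T :=
      Finset.sum_nonneg fun T _ => (div_pos hD0 (hrate T)).le
    linarith
  · intro ha ε hε hεX
    have hq : 3 / 2 * a - 1 ≠ 0 := by linarith
    have h := (hcost ha _ (hX ε hε ha hεX)).1
    rw [← Real.rpow_mul hε.le] at h
    have e : -(3 / 2 * a - 1)⁻¹ * ((3 / 2 * a - 1) / (2 * a - 3 / 2)) = -2 / (4 * a - 3) := by
      have h1 : 2 * a - 3 / 2 ≠ 0 := by linarith
      have h2 : 4 * a - 3 ≠ 0 := by linarith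
      rw [neg_mul, inv_mul_eq_div, div_div_cancel_left' hq, neg_div, inv_eq_one_div,
        neg_inj, div_eq_div_iff h1 h2]
      ring
    rw [e] at h
    rwa [one_mul]
  · intro S A _ _ _ _ _ M d ψ F θ₀ θs Θ εbar T hT hψ hF hconc _ hit hinv hε
    have htriv : optGap M γ ψ F θ₀ θs α₀ a T ≤ D :=
      optGap_le_const hlF hγ0 hγ1 hF θ₀ θs α₀ a T
    have hmain : T₁ ≤ T → _ := fun h =>
      hT₁ S A M d ψ F θ₀ θs Θ εbar T h hψ hF hconc hit hinv hε
    have hlarge : T₀ ≤ T → optGap M γ ψ F θ₀ θs α₀ a T ≤ rate α₀ γ a T := fun h => by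
      have h1 : T₁ ≤ T := (le_max_left _ _).trans h
      have h2 : T₂ ≤ T := (le_max_right _ _).trans h
      exact (hmain h1).trans (hT₂ T h2)
    refine ⟨?_, fun h => by rw [one_mul]; exact hlarge h, fun ha _ ε hε0 hεX hTε => ?_⟩
    · rcases le_or_gt T₀ T with h | h
      · refine (hlarge h).trans (le_mul_of_one_le_left (hrate T).le ?_)
        have : 0 ≤ ∑ T ∈ Finset.range T₀, D / rate α₀ γ a T :=
          Finset.sum_nonneg fun T _ => (div_pos hD0 (hrate T)).le
        linarith
      · have h1 : D / rate α₀ γ a T ≤ ∑ T ∈ Finset.range T₀, D / rate α₀ γ a T :=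
          Finset.single_le_sum (f := fun T => D / rate α₀ γ a T)
            (fun T _ => (div_pos hD0 (hrate T)).le) (Finset.mem_range.2 h)
        refine htriv.trans ?_
        rw [← div_le_iff₀ (hrate T)]
        linarith
    · have hq : 0 < 3 / 2 * a - 1 := by linarith
      have hXε := hX ε hε0 ha hεX
      have hXT : ε ^ (-(3 / 2 * a - 1)⁻¹) ≤ T := (Nat.le_ceil _).trans (by exact_mod_cast hTε)
      have h1 : T₁ ≤ T := by exact_mod_cast ((hcost ha _ hXε).2.trans hXT)
      refine (hmain h1).trans ?_
      have hX0 : 0 < ε ^ (-(3 / 2 * a - 1)⁻¹) := Real.rpow_pos_of_pos hε0 _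
      have h := Real.rpow_le_rpow_of_nonpos hX0
        (hXT.trans (by linarith : (T : ℝ) ≤ (T : ℝ) + 1)) (neg_nonpos.2 hq.le)
      rwa [← Real.rpow_mul hε0.le, neg_mul_neg, inv_mul_cancel₀ hq.ne', Real.rpow_one] at h
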